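/- Let $d\ge 1$, let $\phi:\mathbb R^d\to[0,+\infty]$ be measurable and integrable, with $\phi(-x)=\phi(x)<\infty$ for $x\neq 0$, let $z>0$, and write $L^1=L^1(\mathbb R^d,dx)$ (complex-valued). *Configurations.* $\Gamma$ is the set of locally finite subsets of $\mathbb R^d$, $\Gamma_0$ the set of finite ones, and $\lambda=\sum_{n\ge 0}\frac1{n!}m^{(n)}$ is the Lebesgue–Poisson measure on $\Gamma_0$ ($m^{(n)}$ being the image of Lebesgue measure under $(x_1,\dots,x_n)\mapsto\{x_1,\dots,x_n\}$ on $n$-tuples of distinct points, and $m^{(0)}(\{\emptyset\})=1$). Put $e_\lambda(f,\eta)=\prod_{x\in\eta}f(x)$, $e_\lambda(f,\emptyset)=1$; $(KG)(\gamma)=\sum_{\eta\subset\gamma,\,|\eta|<\infty}G(\eta)$; and $(K^{-1}F)(\eta)=\sum_{\xi\subset\eta}(-1)^{|\eta\setminus\xi|}F(\xi)$. *Operators.* For $\varepsilon>0$ the rescaled Glauber generator is $$(L_\varepsilon F)(\gamma)=\sum_{x\in\gamma}\bigl(F(\gamma\setminus\{x\})-F(\gamma)\bigr)+\frac z\varepsilon\int_{\mathbb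 R^d}e^{-\varepsilon\sum_{y\in\gamma}\phi(x-y)}\bigl(F(\gamma\cup\{x\})-F(\gamma)\bigr)\,dx .$$ Let $\hat L_\varepsilon=K^{-1}L_\varepsilon K$ and $\hat L_{\varepsilon,\mathrm{ren}}=R_{\varepsilon^{-1}}\hat L_\varepsilon R_\varepsilon$, where $(R_\delta G)(\eta)=\delta^{|\eta|}G(\eta)$. *Functionals.* Let $B:L^1\to\mathbb C$ be entire (locally bounded, and $w\mapsto B(\theta_0+w\theta)$ is entire on $\mathbb C$ for all $\theta_0,\theta\in L^1$) and of bounded type (bounded on every ball of $L^1$); this holds in particular if $B$ is entire and $\sup_{\theta\in L^1}|B(\theta)|e^{-\|\theta\|_{L^1}/\alpha}<\infty$ for some $\alpha>0$. Then $B$ has a $\lambda$-a.e. unique correlation function, that is, a measurable $k:\Gamma_0\to\mathbb C$ such that $B(\theta)=\int_{\Gamma_0}e_\lambda(\theta,\eta)k(\eta)\,d\lambda(\eta)$, absolutely convergent, for all $\theta\in L^1$. Further, at every $\theta\in L^1$, $B$ has an a.e. unique variational derivative $\delta B(\theta;\cdot)\in L^\infty(\mathbb R^d)$, that is, $\frac{d}{dw}B(\theta+wh)\big|_{w=0}=\int\delta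 B(\theta;x)h(x)\,dx$ for all $h\in L^1$. Define $$(\tilde L_{\varepsilon,\mathrm{ren}}B)(\theta)=\int_{\Gamma_0}\bigl(\hat L_{\varepsilon,\mathrm{ren}}e_\lambda(\theta)\bigr)(\eta)\,k(\eta)\,d\lambda(\eta).$$ Then for all $\varepsilon>0$ and all $\theta\in L^1$ this integral converges absolutely and $$(\tilde L_{\varepsilon,\mathrm{ren}}B)(\theta)=-\int_{\mathbb R^d}\theta(x)\left(\delta B(\theta;x)-zB\Bigl(\theta e^{-\varepsilon\phi(x-\cdot)}+\frac{e^{-\varepsilon\phi(x-\cdot)}-1}{\varepsilon}\Bigr)\right)dx,$$ where the integral on the right converges absolutely as well. -/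

import Mathlib

open MeasureTheory Filter Topology
open scoped ENNReal

noncomputable section

namespace GlauberGF

/-! ### The space `ℝ^d`, the complex space `L¹`, and configuration spaces -/

/-- `ℝ^d` with its Euclidean structure and Lebesgue measure. -/
abbrev Space (d : ℕ) : Type := EuclideanSpace ℝ (Fin d)

/-- The complex space `L¹ = L¹(ℝ^d, dx)`. -/
abbrev L1 (d : ℕ) : Type := Lp ℂ 1 (volume : Measure (Space d))

/-- The configuration space `Γ`: subsets of `ℝ^d` having finitely many points in every
compact set. -/
@[ext] structure Config (d : ℕ) where
  /-- the underlying set of points -/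
  carrier : Set (Space d)
  locallyFinite : ∀ Λ : Set (Space d), IsCompact Λ → (carrier ∩ Λ).Finite

/-- The space `Γ₀` of finite configurations (the disjoint union over `n` of the `n`-point
configurations). A wrapper of `Finset`, so that it carries the `σ`-algebra defined below rather
than the product `σ`-algebra that Mathlib puts on `Finset`. -/
@[ext] structure FinConfig (d : ℕ) where
  /-- the underlying finite set of points -/
  points : Finset (Space d)

namespace Config

variable {d : ℕ}

/-- The configuration `γ ∪ {x}`. -/
def add (γ : Config d) (x : Space d) : Config d where
  carrier := γ.carrier ∪ {x}
  locallyFinite Λ hΛ := by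
    rw [Set.union_inter_distrib_right]
    exact (γ.locallyFinite Λ hΛ).union ((Set.finite_singleton x).subset Set.inter_subset_left)

/-- The configuration `γ \ {x}`. -/
def remove (γ : Config d) (x : Space d) : Config d where
  carrier := γ.carrier \ {x}
  locallyFinite Λ hΛ :=
    (γ.locallyFinite Λ hΛ).subset (Set.inter_subset_inter_left Λ Set.sdiff_subset)

/-- A finite configuration, seen as an element of `Γ`. -/
def ofFin (η : FinConfig d) : Config d where
  carrier := (η.points : Set (Space d))
  locallyFinite _ _ := η.points.finite_toSet.subset Set.inter_subset_left

end Config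

/-- An ordered tuple of `n` distinct points, seen as an (unordered) `n`-point configuration. -/
def symm (d n : ℕ) (x : {x : Fin n → Space d // Function.Injective x}) : FinConfig d :=
  ⟨Finset.univ.map ⟨x.1, x.2⟩⟩

/-- The `σ`-algebra of `Γ₀`: the `n`-point configurations are identified with the
symmetrization of the set of `n`-tuples of distinct points, so a set is measurable iff, for
every `n`, its preimage in the set of `n`-tuples of distinct points is a Borel set. -/
instance finConfigMeasurableSpace (d : ℕ) : MeasurableSpace (FinConfig d) :=
  ⨅ n : ℕ, MeasurableSpace.map (symm d n) inferInstance

/-- The Lebesgue--Poisson measure `λ = ∑ₙ m⁽ⁿ⁾ / n!` on `Γ₀`, where `m⁽ⁿ⁾` is the image of the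
Lebesgue measure on `n`-tuples of distinct points. -/
def lebesguePoisson (d : ℕ) : Measure (FinConfig d) :=
  Measure.sum fun n : ℕ =>
    ((n.factorial : ℝ≥0∞))⁻¹ •
      Measure.map (symm d n)
        (Measure.comap (Subtype.val : {x : Fin n → Space d // Function.Injective x} → _) volume)

/-- The coherent state `e_λ(f, η) = ∏_{x ∈ η} f(x)`, with `e_λ(f, ∅) = 1`. -/
def coherent {d : ℕ} (f : Space d → ℂ) (η : FinConfig d) : ℂ := ∏ x ∈ η.points, f x

/-- The `K`-transform `(KG)(γ) = ∑_{η ⊆ γ, |η| < ∞} G(η)`. -/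
def kTransform {d : ℕ} (G : FinConfig d → ℂ) (γ : Config d) : ℂ :=
  ∑' η : {η : FinConfig d // (η.points : Set (Space d)) ⊆ γ.carrier}, G η.1

open Classical in
/-- The inverse `K`-transform `(K⁻¹F)(η) = ∑_{ξ ⊆ η} (-1)^{|η \ ξ|} F(ξ)`. -/
def kInverse {d : ℕ} (F : Config d → ℂ) (η : FinConfig d) : ℂ :=
  ∑ ξ ∈ η.points.powerset, (-1) ^ (η.points \ ξ).card * F (Config.ofFin ⟨ξ⟩)

/-! ### The Glauber dynamics -/

/-- A non-negative integrable pair potential `φ : ℝ^d → [0, +∞]`, even, and finite away from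
the origin. -/
structure PairPotential (d : ℕ) where
  /-- the potential -/
  toFun : Space d → ℝ≥0∞
  measurable : Measurable toFun
  even : ∀ x, toFun (-x) = toFun x
  finite : ∀ x, x ≠ 0 → toFun x ≠ ⊤
  integrable : ∫⁻ x, toFun x ≠ ⊤

/-- `e^{-a}` for `a ∈ [0, +∞]`, with `e^{-∞} = 0`. -/
def expNeg (a : ℝ≥0∞) : ℝ := if a = ⊤ then 0 else Real.exp (-a.toReal)

/-- The relative energy `E(x, γ) = ∑_{y ∈ γ} φ(x - y) ∈ [0, +∞]`. -/
def energy {d : ℕ} (φ : Space d → ℝ≥0∞) (x : Space d) (γ : Config d) : ℝ≥0∞ :=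
  ∑' y : γ.carrier, φ (x - y.1)

/-- The Glauber generator with potential `φ` and activity `z`:
`(LF)(γ) = ∑_{x ∈ γ} (F(γ \ {x}) - F(γ)) + z ∫ e^{-E(x, γ)} (F(γ ∪ {x}) - F(γ)) dx`. -/
def glauber {d : ℕ} (φ : Space d → ℝ≥0∞) (z : ℝ) (F : Config d → ℂ) (γ : Config d) : ℂ :=
  (∑' x : γ.carrier, (F (γ.remove x.1) - F γ)) +
    (z : ℂ) * ∫ x : Space d, (expNeg (energy φ x γ) : ℂ) * (F (γ.add x) - F γ)

/-- The rescaled generator `L_ε`: `φ` is replaced by `ε φ` and `z` by `ε⁻¹ z`. -/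
def glauberScaled {d : ℕ} (φ : PairPotential d) (z ε : ℝ) (F : Config d → ℂ) :
    Config d → ℂ :=
  glauber (fun x => ENNReal.ofReal ε * φ.toFun x) (z / ε) F

/-- The operator `L̂_ε = K⁻¹ L_ε K` on functions on `Γ₀`. -/
def hatScaled {d : ℕ} (φ : PairPotential d) (z ε : ℝ) (G : FinConfig d → ℂ) :
    FinConfig d → ℂ :=
  kInverse (glauberScaled φ z ε (kTransform G))

/-- The renormalized operator `L̂_{ε,ren} = R_{1/ε} L̂_ε R_ε` with `(R_ε G)(η) = ε^{|η|} G(η)`.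
It is the pre-dual of the evolution of `k_ren(η) = ε^{|η|} k(η)` when `k` evolves by the dual
of `L̂_ε`. -/
def hatRen {d : ℕ} (φ : PairPotential d) (z ε : ℝ) (G : FinConfig d → ℂ)
    (η : FinConfig d) : ℂ :=
  ((ε : ℂ)⁻¹) ^ η.points.card * hatScaled φ z ε (fun ξ => (ε : ℂ) ^ ξ.points.card * G ξ) η

/-! ### Functionals on `L¹` -/

/-- `B : L¹ → ℂ` is entire: locally bounded, and entire along every complex line. -/
def IsEntire {d : ℕ} (B : L1 d → ℂ) : Prop :=
  (∀ θ₀ : L1 d, ∃ C : ℝ, ∀ᶠ θ in 𝓝 θ₀, ‖B θ‖ ≤ C) ∧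
    ∀ θ₀ θ : L1 d, Differentiable ℂ fun w : ℂ => B (θ₀ + w • θ)

/-- `B` is bounded on all balls of `L¹`. -/
def IsOfBoundedType {d : ℕ} (B : L1 d → ℂ) : Prop :=
  ∀ θ₀ : L1 d, ∀ r : ℝ, 0 < r → ∃ C : ℝ, ∀ θ : L1 d, ‖θ‖ ≤ r → ‖B (θ₀ + θ)‖ ≤ C

/-- `g` is the (first) variational derivative of `B` at `θ`: `g ∈ L^∞`, and the derivative of
`B` at `θ` in the direction `h` is `∫ g(x) h(x) dx` for all `h ∈ L¹`. -/
def IsVariationalDerivative {d : ℕ} (B : L1 d → ℂ) (θ : L1 d) (g : Space d → ℂ) : Prop :=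
  MemLp g ⊤ volume ∧
    ∀ h : L1 d, HasDerivAt (fun w : ℂ => B (θ + w • h)) (∫ x, g x * h x) 0

open Classical in
/-- The variational derivative `δB(θ; ·)` (zero if there is none). -/
def variationalDerivative {d : ℕ} (B : L1 d → ℂ) (θ : L1 d) : Space d → ℂ :=
  if h : ∃ g, IsVariationalDerivative B θ g then h.choose else 0

/-- `k` is the correlation function of `B`:
`B(θ) = ∫ e_λ(θ, η) k(η) dλ(η)`, absolutely convergent, for all `θ ∈ L¹`. -/
def IsCorrelationFunction {d : ℕ} (B : L1 d → ℂ) (k : FinConfig d → ℂ) : Prop :=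
  Measurable k ∧ ∀ θ : L1 d,
    Integrable (fun η => coherent θ η * k η) (lebesguePoisson d) ∧
      B θ = ∫ η, coherent θ η * k η ∂(lebesguePoisson d)

open Classical in
/-- The correlation function of `B` (zero if there is none). -/
def correlationFunction {d : ℕ} (B : L1 d → ℂ) : FinConfig d → ℂ :=
  if h : ∃ k, IsCorrelationFunction B k then h.choose else 0

/-- The renormalized rescaled Glauber operator on generating functionals,
`(L̃_{ε,ren} B)(θ) = ∫ (L̂_{ε,ren} e_λ(θ))(η) k(η) dλ(η)`, with `k` the correlation function
of `B`. -/
def tildeRen {d : ℕ} (φ : PairPotential d) (z ε : ℝ) (B : L1 d → ℂ) (θ : L1 d) : ℂ :=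
  ∫ η, hatRen φ z ε (coherent θ) η * correlationFunction B η ∂(lebesguePoisson d)

/-! ### The argument `θ e^{-εφ(x - ·)} + (e^{-εφ(x - ·)} - 1) / ε` as an element of `L¹` -/

lemma expNeg_nonneg (a : ℝ≥0∞) : 0 ≤ expNeg a := by
  unfold expNeg; split_ifs <;> positivity

lemma expNeg_le_one (a : ℝ≥0∞) : expNeg a ≤ 1 := by
  unfold expNeg; split_ifs
  · exact zero_le_one
  · exact Real.exp_le_one_iff.2 (by simp)

lemma measurable_expNeg : Measurable expNeg :=
  Measurable.ite (measurableSet_singleton _) measurable_const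
    (Real.measurable_exp.comp ENNReal.measurable_toReal.neg)

lemma one_sub_expNeg_le (a : ℝ≥0∞) (ha : a ≠ ⊤) : 1 - expNeg a ≤ a.toReal := by
  have := Real.add_one_le_exp (-a.toReal)
  simp only [expNeg, ha, if_false]
  linarith

/-- The function `y ↦ θ(y) e^{-εφ(x - y)} + (e^{-εφ(x - y)} - 1) / ε`. -/
def shiftFun {d : ℕ} (φ : PairPotential d) (ε : ℝ) (θ : L1 d) (x y : Space d) : ℂ :=
  θ y * (expNeg (ENNReal.ofReal ε * φ.toFun (x - y)) : ℂ) +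
    ((expNeg (ENNReal.ofReal ε * φ.toFun (x - y)) : ℂ) - 1) / (ε : ℂ)

lemma memLp_shiftFun {d : ℕ} (φ : PairPotential d) (ε : ℝ) (θ : L1 d) (x : Space d) :
    MemLp (shiftFun φ ε θ x) 1 volume := by
  have hφm : Measurable fun y : Space d => φ.toFun (x - y) :=
    φ.measurable.comp (measurable_const.sub measurable_id)
  have hm : Measurable fun y : Space d =>
      (expNeg (ENNReal.ofReal ε * φ.toFun (x - y)) : ℂ) :=
    Complex.measurable_ofReal.comp (measurable_expNeg.comp (hφm.const_mul _))
  rw [memLp_one_iff_integrable]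
  refine Integrable.add ?_ ?_
  · refine (L1.integrable_coeFn θ).mul_bdd (c := 1) hm.aestronglyMeasurable
      (ae_of_all _ fun y => ?_)
    rw [Complex.norm_real, Real.norm_of_nonneg (expNeg_nonneg _)]
    exact expNeg_le_one _
  · have hlint : ∫⁻ y, φ.toFun (x - y) ≠ ⊤ := by
      rw [lintegral_sub_left_eq_self (fun y => φ.toFun y) x]
      exact φ.integrable
    have hint : Integrable fun y : Space d => (φ.toFun (x - y)).toReal :=
      integrable_toReal_of_lintegral_ne_top hφm.aemeasurable hlint
    refine hint.mono' ((hm.sub_const 1).div_const _).aestronglyMeasurable ?_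
    filter_upwards [ae_lt_top hφm hlint] with y hy
    rcases le_or_gt ε 0 with hε | hε
    · simp [ENNReal.ofReal_of_nonpos hε, expNeg]
    · have hne : ENNReal.ofReal ε * φ.toFun (x - y) ≠ ⊤ :=
        ENNReal.mul_ne_top ENNReal.ofReal_ne_top hy.ne
      have h1 := one_sub_expNeg_le _ hne
      rw [ENNReal.toReal_mul, ENNReal.toReal_ofReal hε.le] at h1
      rw [norm_div, Complex.norm_real, Real.norm_of_nonneg hε.le, div_le_iff₀ hε,
        ← Complex.ofReal_one, ← Complex.ofReal_sub, Complex.norm_real, Real.norm_eq_abs,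
        abs_sub_comm, abs_of_nonneg (sub_nonneg.2 (expNeg_le_one _))]
      linarith

/-- The element `θ e^{-εφ(x - ·)} + (e^{-εφ(x - ·)} - 1) / ε` of `L¹`. -/
def shift {d : ℕ} (φ : PairPotential d) (ε : ℝ) (θ : L1 d) (x : Space d) : L1 d :=
  (memLp_shiftFun φ ε θ x).toLp _

end GlauberGF

end

noncomputable section

namespace GlauberGF

/-! ### Entire functions of bounded type on a complex normed space -/

section Entire

variable {E : Type*} [NormedAddCommGroup E] [NormedSpace ℂ E]

/-- Entire along complex lines and bounded on balls. -/
structure BddEntire (f : E → ℂ) : Prop where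
  line : ∀ θ₀ θ : E, Differentiable ℂ fun w : ℂ => f (θ₀ + w • θ)
  bdd : ∀ R : ℝ, ∃ C : ℝ, ∀ θ : E, ‖θ‖ ≤ R → ‖f θ‖ ≤ C

lemma norm_deriv_le_of_norm_le {g : ℂ → ℂ} (hg : Differentiable ℂ g) {R ρ M : ℝ} (hρ : 0 < ρ)
    (hM : ∀ w, ‖w‖ ≤ R + ρ → ‖g w‖ ≤ M) {w : ℂ} (hw : ‖w‖ ≤ R) : ‖deriv g w‖ ≤ M / ρ := by
  refine Complex.norm_deriv_le_of_forall_mem_sphere_norm_le hρ hg.diffContOnCl fun v hv => hM v ?_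
  have : ‖v‖ ≤ ‖w‖ + ‖v - w‖ := by simpa using norm_add_le w (v - w)
  rw [mem_sphere_iff_norm.1 hv] at this
  linarith

lemma norm_sub_sub_mul_deriv_le {g : ℂ → ℂ} (hg : Differentiable ℂ g) {M : ℝ}
    (hM : ∀ w, ‖w‖ ≤ 3 → ‖g w‖ ≤ M) {t : ℂ} (ht : ‖t‖ ≤ 1) :
    ‖g t - g 0 - t * deriv g 0‖ ≤ M * ‖t‖ ^ 2 := by
  have hg' : Differentiable ℂ (deriv g) := by
    have := (hg.contDiff (n := 2))
    exact ((contDiff_succ_iff_deriv (n := 1)).1 this).2.2.differentiable (by norm_num)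
  have h1 : ∀ w : ℂ, ‖w‖ ≤ 2 → ‖deriv g w‖ ≤ M := fun w hw => by
    simpa using norm_deriv_le_of_norm_le hg (R := 2) (ρ := 1) one_pos
      (fun v hv => hM v (by linarith)) hw
  have h2 : ∀ w : ℂ, ‖w‖ ≤ 1 → ‖deriv (deriv g) w‖ ≤ M := fun w hw => by
    simpa using norm_deriv_le_of_norm_le hg' (R := 1) (ρ := 1) one_pos
      (fun v hv => h1 v (by linarith)) hw
  have h3 : ∀ w : ℂ, ‖w‖ ≤ 1 → ‖deriv g w - deriv g 0‖ ≤ M * ‖w‖ := fun w hw => by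
    have := (convex_closedBall (0 : ℂ) 1).norm_image_sub_le_of_norm_deriv_le
      (f := deriv g) (C := M) (fun x _ => hg' x) (fun x hx => h2 x (by simpa using hx))
      (x := 0) (y := w) (by simp) (by simpa using hw)
    simpa using this
  have hd : ∀ x, HasDerivAt (fun w => g w - w * deriv g 0) (deriv g x - deriv g 0) x := fun x => by
    simpa using (hg x).hasDerivAt.fun_sub ((hasDerivAt_id' x).mul_const (deriv g 0))
  have h0 : 0 ≤ M := (norm_nonneg _).trans (hM 0 (by simp))
  have := (convex_closedBall (0 : ℂ) ‖t‖).norm_image_sub_le_of_norm_deriv_le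
      (f := fun w => g w - w * deriv g 0) (C := M * ‖t‖) (fun x _ => (hd x).differentiableAt)
      (fun x hx => by
        have hx : ‖x‖ ≤ ‖t‖ := by simpa using hx
        rw [(hd x).deriv]
        exact (h3 x (hx.trans ht)).trans (by gcongr))
      (x := 0) (y := t) (by simp) (by simp)
  have e : g t - t * deriv g 0 - (g 0 - 0 * deriv g 0) = g t - g 0 - t * deriv g 0 := by ring
  rw [e] at this
  simpa [pow_two, mul_assoc] using this

namespace BddEntire

variable {f : E → ℂ}

lemma hasDerivAt_line (hf : BddEntire f) (θ h : E) (w : ℂ) :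
    HasDerivAt (fun w : ℂ => f (θ + w • h)) (lineDeriv ℂ f (θ + w • h) h) w := by
  have h1 := ((hf.line (θ + w • h) h) 0).hasDerivAt
  have h2 : HasDerivAt (fun v : ℂ => v - w) 1 w := (hasDerivAt_id w).sub_const w
  have h3 := HasDerivAt.comp (h₂ := fun v : ℂ => f (θ + w • h + v • h)) w
    (by rw [sub_self]; exact h1) h2
  rw [mul_one] at h3
  refine h3.congr_of_eventuallyEq (Eventually.of_forall fun v => ?_)
  simp only [Function.comp]
  congr 1
  rw [sub_smul]; abel

lemma norm_lineDeriv_le (hf : BddEntire f) {R ρ M : ℝ} (hρ : 0 < ρ)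
    (hM : ∀ θ, ‖θ‖ ≤ R + ρ → ‖f θ‖ ≤ M) {θ : E} (hθ : ‖θ‖ ≤ R) (h : E) :
    ‖lineDeriv ℂ f θ h‖ ≤ M / ρ * ‖h‖ := by
  rcases eq_or_ne h 0 with rfl | hh
  · simp [lineDeriv_zero]
  have hh' : 0 < ‖h‖ := norm_pos_iff.2 hh
  have := norm_deriv_le_of_norm_le (hf.line θ h) (R := 0) (ρ := ρ / ‖h‖) (M := M) (by positivity)
    (fun w hw => hM _ ?_) (w := 0) (by simp)
  · rw [div_div_eq_mul_div] at this
    rw [lineDeriv, div_mul_eq_mul_div]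
    exact this
  · rw [zero_add, le_div_iff₀ hh'] at hw
    calc ‖θ + w • h‖ ≤ ‖θ‖ + ‖w • h‖ := norm_add_le _ _
      _ ≤ R + ρ := by rw [norm_smul]; linarith

lemma exists_norm_slope_sub_le (hf : BddEntire f) (h : E) (R : ℝ) :
    ∃ C : ℝ, 0 ≤ C ∧ ∀ θ : E, ‖θ‖ ≤ R → ∀ t : ℂ, t ≠ 0 → ‖t‖ ≤ 1 →
      ‖t⁻¹ * (f (θ + t • h) - f θ) - lineDeriv ℂ f θ h‖ ≤ C * ‖t‖ := by
  obtain ⟨C, hC⟩ := hf.bdd (R + 3 * ‖h‖)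
  refine ⟨max C 0, le_max_right _ _, fun θ hθ t ht0 ht => ?_⟩
  have := norm_sub_sub_mul_deriv_le (hf.line θ h) (M := max C 0) (fun w hw => ?_) ht
  · have e : t⁻¹ * (f (θ + t • h) - f θ) - lineDeriv ℂ f θ h =
        t⁻¹ * (f (θ + t • h) - f (θ + (0 : ℂ) • h) - t * lineDeriv ℂ f θ h) := by
      rw [zero_smul, add_zero]; field_simp
    rw [e, norm_mul, norm_inv]
    have ht' : 0 < ‖t‖ := norm_pos_iff.2 ht0
    rw [inv_mul_le_iff₀ ht']
    calc _ ≤ _ := this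
      _ = _ := by ring
  · refine (hC _ ?_).trans (le_max_left _ _)
    calc ‖θ + w • h‖ ≤ ‖θ‖ + ‖w‖ * ‖h‖ := (norm_add_le _ _).trans (by rw [norm_smul])
      _ ≤ R + 3 * ‖h‖ := by gcongr

lemma lineDeriv (hf : BddEntire f) (h : E) : BddEntire fun θ => lineDeriv ℂ f θ h where
  bdd R := by
    obtain ⟨C, hC⟩ := hf.bdd (R + 1)
    exact ⟨_, fun θ hθ => hf.norm_lineDeriv_le one_pos hC hθ h⟩
  line θ₀ θ := by
    let u : ℕ → ℂ := fun n => (n + 1 : ℂ)⁻¹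
    have hu0 : ∀ n, u n ≠ 0 := fun n => inv_ne_zero (by exact_mod_cast n.succ_ne_zero)
    have hun : ∀ n, ‖u n‖ = 1 / ((n : ℝ) + 1) := fun n => by
      have : (n + 1 : ℂ) = ((n + 1 : ℝ) : ℂ) := by push_cast; rfl
      simp only [u]
      rw [norm_inv, this, Complex.norm_real, Real.norm_of_nonneg (by positivity), one_div]
    have hu1 : ∀ n, ‖u n‖ ≤ 1 := fun n => by
      rw [hun, div_le_one (by positivity)]; linarith [(Nat.cast_nonneg n : (0 : ℝ) ≤ n)]
    intro w₀
    let U : Set ℂ := Metric.ball 0 (‖w₀‖ + 1)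
    have key : TendstoUniformlyOn
        (fun n (w : ℂ) => (u n)⁻¹ * (f (θ₀ + w • θ + u n • h) - f (θ₀ + w • θ)))
        (fun w => _root_.lineDeriv ℂ f (θ₀ + w • θ) h) atTop U := by
      obtain ⟨C, hC0, hC⟩ := hf.exists_norm_slope_sub_le h (‖θ₀‖ + (‖w₀‖ + 1) * ‖θ‖)
      rw [Metric.tendstoUniformlyOn_iff]
      intro δ hδ
      have hlim : Tendsto (fun n => C * ‖u n‖) atTop (𝓝 0) := by
        simp_rw [hun]
        simpa using tendsto_one_div_add_atTop_nhds_zero_nat.const_mul C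
      filter_upwards [hlim.eventually_lt_const hδ] with n hn w hw
      rw [dist_comm, dist_eq_norm]
      refine (hC _ ?_ _ (hu0 n) (hu1 n)).trans_lt hn
      have : ‖w‖ ≤ ‖w₀‖ + 1 := (mem_ball_zero_iff.1 hw).le
      calc ‖θ₀ + w • θ‖ ≤ ‖θ₀‖ + ‖w‖ * ‖θ‖ := (norm_add_le _ _).trans (by rw [norm_smul])
        _ ≤ _ := by gcongr
    refine (key.tendstoLocallyUniformlyOn.differentiableOn (Eventually.of_forall fun n => ?_)
      Metric.isOpen_ball).differentiableAt (Metric.isOpen_ball.mem_nhds (by simp))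
    have h1 := hf.line (θ₀ + u n • h) θ
    have h2 : (fun w : ℂ => f (θ₀ + w • θ + u n • h)) = fun w : ℂ => f (θ₀ + u n • h + w • θ) := by
      ext w; congr 1; abel
    exact (((h2 ▸ h1).sub (hf.line θ₀ θ)).const_mul _).differentiableOn

lemma lineDeriv_add (hf : BddEntire f) (θ h₁ h₂ : E) :
    _root_.lineDeriv ℂ f θ (h₁ + h₂) =
      _root_.lineDeriv ℂ f θ h₁ + _root_.lineDeriv ℂ f θ h₂ := by
  have l0 : Tendsto (fun t : ℂ => t) (𝓝[≠] 0) (𝓝 0) := nhdsWithin_le_nhds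
  have t1 := (hf.hasDerivAt_line θ (h₁ + h₂) 0).tendsto_slope_zero
  have t2 := (hf.hasDerivAt_line θ h₁ 0).tendsto_slope_zero
  simp only [zero_add, zero_smul, add_zero, smul_eq_mul] at t1 t2
  have t3 : Tendsto (fun t : ℂ => _root_.lineDeriv ℂ f (θ + t • h₁) h₂) (𝓝[≠] 0)
      (𝓝 (_root_.lineDeriv ℂ f θ h₂)) := by
    have := ((hf.lineDeriv h₂).line θ h₁).continuous.tendsto 0
    simp only [zero_smul, add_zero] at this
    exact this.mono_left nhdsWithin_le_nhds
  obtain ⟨C, hC0, hC⟩ := hf.exists_norm_slope_sub_le h₂ (‖θ‖ + ‖h₁‖)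
  have t4 : Tendsto (fun t : ℂ => t⁻¹ * (f (θ + t • h₁ + t • h₂) - f (θ + t • h₁)) -
      _root_.lineDeriv ℂ f (θ + t • h₁) h₂) (𝓝[≠] 0) (𝓝 0) := by
    refine squeeze_zero_norm' (a := fun t => C * ‖t‖) ?_ ?_
    · have e1 : ∀ᶠ t : ℂ in 𝓝[≠] 0, ‖t‖ ≤ 1 := by
        have := (l0.norm).eventually_le_const (u := 1) (by simp)
        exact this
      filter_upwards [e1, self_mem_nhdsWithin] with t ht ht0
      refine hC _ ?_ t ht0 ht
      calc ‖θ + t • h₁‖ ≤ ‖θ‖ + ‖t‖ * ‖h₁‖ := (norm_add_le _ _).trans (by rw [norm_smul])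
        _ ≤ ‖θ‖ + 1 * ‖h₁‖ := by gcongr
        _ = _ := by ring
    · simpa using l0.norm.const_mul C
  have t5 := (t2.add t4).add t3
  rw [add_zero] at t5
  refine tendsto_nhds_unique t1 (t5.congr fun t => ?_)
  rw [smul_add, ← add_assoc]
  ring

lemma exists_hasDerivAt (hf : BddEntire f) (θ : E) :
    ∃ Λ : E →L[ℂ] ℂ, ∀ h, HasDerivAt (fun w : ℂ => f (θ + w • h)) (Λ h) 0 := by
  obtain ⟨C, hC⟩ := hf.bdd (‖θ‖ + 1)
  refine ⟨LinearMap.mkContinuous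
    { toFun := fun h => _root_.lineDeriv ℂ f θ h
      map_add' := hf.lineDeriv_add θ
      map_smul' := fun c h => _root_.lineDeriv_smul } (C / 1)
    (fun h => hf.norm_lineDeriv_le one_pos hC le_rfl h), fun h => ?_⟩
  simpa using hf.hasDerivAt_line θ h 0

end BddEntire

/-- The iterated directional derivative `D_{h₀} ⋯ D_{hₙ₋₁} f`. -/
def iterLineDeriv (f : E → ℂ) : (n : ℕ) → (Fin n → E) → E → ℂ
  | 0, _ => f
  | n + 1, h => fun θ => lineDeriv ℂ (iterLineDeriv f n (Fin.tail h)) θ (h 0)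

namespace BddEntire

variable {f : E → ℂ}

lemma iterLineDeriv (hf : BddEntire f) : ∀ (n : ℕ) (h : Fin n → E),
    BddEntire (iterLineDeriv f n h)
  | 0, _ => hf
  | n + 1, h => (hf.iterLineDeriv n (Fin.tail h)).lineDeriv (h 0)

lemma iterLineDeriv_update_add (hf : BddEntire f) : ∀ (n : ℕ) (m : Fin n → E) (i : Fin n)
    (x y : E) (θ : E), GlauberGF.iterLineDeriv f n (Function.update m i (x + y)) θ =
      GlauberGF.iterLineDeriv f n (Function.update m i x) θ +
        GlauberGF.iterLineDeriv f n (Function.update m i y) θ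
  | 0, _, i, _, _, _ => i.elim0
  | n + 1, m, i, x, y, θ => by
    refine Fin.cases ?_ (fun j => ?_) i
    · simp only [GlauberGF.iterLineDeriv, Fin.tail_update_zero, Function.update_self]
      exact (hf.iterLineDeriv n _).lineDeriv_add θ x y
    · simp only [GlauberGF.iterLineDeriv, Fin.tail_update_succ]
      rw [Function.update_of_ne (Fin.succ_ne_zero j).symm,
        Function.update_of_ne (Fin.succ_ne_zero j).symm,
        Function.update_of_ne (Fin.succ_ne_zero j).symm,
        funext (hf.iterLineDeriv_update_add n (Fin.tail m) j x y)]
      have h1 := (hf.iterLineDeriv n (Function.update (Fin.tail m) j x)).hasDerivAt_line θ (m 0) 0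
      have h2 := (hf.iterLineDeriv n (Function.update (Fin.tail m) j y)).hasDerivAt_line θ (m 0) 0
      have := (h1.fun_add h2).deriv
      simp only [zero_smul, add_zero] at this
      exact this

lemma iterLineDeriv_update_smul (hf : BddEntire f) : ∀ (n : ℕ) (m : Fin n → E) (i : Fin n)
    (c : ℂ) (x : E) (θ : E), GlauberGF.iterLineDeriv f n (Function.update m i (c • x)) θ =
      c * GlauberGF.iterLineDeriv f n (Function.update m i x) θ
  | 0, _, i, _, _, _ => i.elim0
  | n + 1, m, i, c, x, θ => by
    refine Fin.cases ?_ (fun j => ?_) i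
    · simp only [GlauberGF.iterLineDeriv, Fin.tail_update_zero, Function.update_self]
      exact _root_.lineDeriv_smul
    · simp only [GlauberGF.iterLineDeriv, Fin.tail_update_succ]
      rw [Function.update_of_ne (Fin.succ_ne_zero j).symm,
        Function.update_of_ne (Fin.succ_ne_zero j).symm,
        funext (hf.iterLineDeriv_update_smul n (Fin.tail m) j c x)]
      have h1 := (hf.iterLineDeriv n (Function.update (Fin.tail m) j x)).hasDerivAt_line θ (m 0) 0
      have := (h1.const_mul c).deriv
      simp only [zero_smul, add_zero] at this
      exact this

lemma norm_iterLineDeriv_le (hf : BddEntire f) {ρ M : ℝ} (hρ : 0 < ρ) : ∀ (n : ℕ) (R : ℝ),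
    (∀ θ, ‖θ‖ ≤ R + n * ρ → ‖f θ‖ ≤ M) → ∀ (h : Fin n → E) (θ : E), ‖θ‖ ≤ R →
      ‖GlauberGF.iterLineDeriv f n h θ‖ ≤ M / ρ ^ n * ∏ i, ‖h i‖
  | 0, R, hM, h, θ, hθ => by
    simpa [GlauberGF.iterLineDeriv] using hM θ (by simpa using hθ)
  | n + 1, R, hM, h, θ, hθ => by
    have ih := hf.norm_iterLineDeriv_le hρ n (R + ρ) (fun θ' h' => hM θ' (by
      push_cast; linarith)) (Fin.tail h)
    refine ((hf.iterLineDeriv n (Fin.tail h)).norm_lineDeriv_le hρ ih hθ (h 0)).trans_eq ?_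
    rw [Fin.prod_univ_succ, pow_succ]
    simp only [Fin.tail]
    field_simp

lemma iteratedDeriv_line (hf : BddEntire f) (θ : E) (n : ℕ) (w : ℂ) :
    iteratedDeriv n (fun w : ℂ => f (w • θ)) w =
      GlauberGF.iterLineDeriv f n (fun _ => θ) (w • θ) := by
  induction n generalizing w with
  | zero => simp [GlauberGF.iterLineDeriv]
  | succ n ih =>
    rw [iteratedDeriv_succ, funext ih]
    have := ((hf.iterLineDeriv n fun _ => θ).hasDerivAt_line 0 θ w).deriv
    simp only [zero_add] at this
    exact this

/-- The `n`-th differential of `f` at `0`, a multilinear form. -/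
def differential (hf : BddEntire f) (n : ℕ) : MultilinearMap ℂ (fun _ : Fin n => E) ℂ where
  toFun h := GlauberGF.iterLineDeriv f n h 0
  map_update_add' {inst} m i x y := by
    obtain rfl := Subsingleton.elim inst (instDecidableEqFin n)
    exact hf.iterLineDeriv_update_add n m i x y 0
  map_update_smul' {inst} m i c x := by
    obtain rfl := Subsingleton.elim inst (instDecidableEqFin n)
    exact hf.iterLineDeriv_update_smul n m i c x 0

lemma norm_differential_le (hf : BddEntire f) {r M : ℝ} (hr : 0 < r)
    (hM : ∀ θ, ‖θ‖ ≤ r → ‖f θ‖ ≤ M) (n : ℕ) (h : Fin n → E) :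
    ‖hf.differential n h‖ ≤ M * (n / r) ^ n * ∏ i, ‖h i‖ := by
  rcases Nat.eq_zero_or_pos n with rfl | hn
  · simpa [differential, GlauberGF.iterLineDeriv] using hM 0 (by simpa using hr.le)
  have hn' : (0 : ℝ) < n := by exact_mod_cast hn
  have := hf.norm_iterLineDeriv_le (ρ := r / n) (M := M) (by positivity) n 0 (fun θ hθ => hM θ (by
    rw [zero_add, mul_div_cancel₀ _ hn'.ne'] at hθ; exact hθ)) h 0 (by simp)
  refine this.trans_eq ?_
  rw [div_pow, div_pow, div_div_eq_mul_div, mul_div_assoc]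

lemma iteratedDeriv_zero_eq_differential (hf : BddEntire f) (θ : E) (n : ℕ) :
    iteratedDeriv n (fun w : ℂ => f (w • θ)) 0 = hf.differential n fun _ => θ := by
  rw [hf.iteratedDeriv_line, zero_smul]; rfl

end BddEntire
end Entire

/-! ### The dual of `L¹` of a `σ`-finite measure -/

section Dual

variable {α : Type*} [MeasurableSpace α] {μ : Measure α}

lemma norm_L1_eq (f : Lp ℂ 1 μ) : ‖f‖ = ∫ x, ‖f x‖ ∂μ := L1.norm_eq_integral_norm f

lemma ae_re_mul_le_of_norm_setIntegral_le [SigmaFinite μ] {g : α → ℂ} {b : α → ℝ}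
    (hg : ∀ s, MeasurableSet s → μ s < ∞ → IntegrableOn g s μ)
    (hb : ∀ s, MeasurableSet s → μ s < ∞ → IntegrableOn b s μ)
    (h : ∀ s, MeasurableSet s → μ s < ∞ → ‖∫ x in s, g x ∂μ‖ ≤ ∫ x in s, b x ∂μ)
    {c : ℂ} (hc : ‖c‖ = 1) : ∀ᵐ x ∂μ, (c * g x).re ≤ b x := by
  have := ae_nonneg_of_forall_setIntegral_nonneg_of_sigmaFinite (μ := μ)
    (f := fun x => b x - (c * g x).re)
    (fun s hs hμ => (hb s hs hμ).sub ((hg s hs hμ).const_mul c).re)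
    (fun s hs hμ => by
      have hre : IntegrableOn (fun x => (c * g x).re) s μ := ((hg s hs hμ).const_mul c).re
      rw [integral_sub (hb s hs hμ) hre, sub_nonneg]
      have e : ∫ x in s, (c * g x).re ∂μ = (∫ x in s, c * g x ∂μ).re :=
        integral_re ((hg s hs hμ).const_mul c)
      rw [e, integral_const_mul]
      refine (Complex.re_le_norm _).trans ?_
      rw [norm_mul, hc, one_mul]
      exact h s hs hμ)
  filter_upwards [this] with x hx
  simpa using hx

lemma ae_norm_le_of_norm_setIntegral_le [SigmaFinite μ] {g : α → ℂ} {b : α → ℝ}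
    (hg : ∀ s, MeasurableSet s → μ s < ∞ → IntegrableOn g s μ)
    (hb : ∀ s, MeasurableSet s → μ s < ∞ → IntegrableOn b s μ)
    (h : ∀ s, MeasurableSet s → μ s < ∞ → ‖∫ x in s, g x ∂μ‖ ≤ ∫ x in s, b x ∂μ) :
    ∀ᵐ x ∂μ, ‖g x‖ ≤ 2 * b x := by
  filter_upwards [ae_re_mul_le_of_norm_setIntegral_le hg hb h (c := 1) (by simp),
    ae_re_mul_le_of_norm_setIntegral_le hg hb h (c := -1) (by simp),
    ae_re_mul_le_of_norm_setIntegral_le hg hb h (c := Complex.I) (by simp),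
    ae_re_mul_le_of_norm_setIntegral_le hg hb h (c := -Complex.I) (by simp)] with x h1 h2 h3 h4
  simp only [one_mul, neg_mul, Complex.neg_re, Complex.I_mul_re, neg_neg] at h1 h2 h3 h4
  refine (Complex.norm_le_abs_re_add_abs_im _).trans ?_
  linarith [abs_le.2 ⟨neg_le.1 h2, h1⟩, abs_le.2 ⟨neg_le.1 h3, h4⟩]

lemma exists_pos_integrable (μ : Measure α) [SigmaFinite μ] :
    ∃ w : α → ℝ, (∀ x, 0 < w x) ∧ Measurable w ∧ Integrable w μ := by
  obtain ⟨w, h0, hm, hi⟩ := exists_pos_lintegral_lt_of_sigmaFinite μ one_ne_zero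
  refine ⟨fun x => w x, fun x => by exact_mod_cast h0 x, hm.coe_nnreal_real,
    hm.coe_nnreal_real.aestronglyMeasurable, ?_⟩
  rw [hasFiniteIntegral_iff_enorm]
  simpa using hi.trans ENNReal.one_lt_top

/-- Bounded linear functionals on `L¹` are given by bounded functions. -/
theorem exists_bounded_of_dual_L1 [SigmaFinite μ] (Λ : Lp ℂ 1 μ →L[ℂ] ℂ) :
    ∃ g : α → ℂ, Measurable g ∧ (∀ x, ‖g x‖ ≤ 2 * ‖Λ‖) ∧ ∀ f : Lp ℂ 1 μ, Λ f = ∫ x, g x * f x ∂μ := by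
  obtain ⟨w, w0, wm, wi⟩ := exists_pos_integrable μ
  let s : α → ℝ := fun x => √(w x)
  have s0 : ∀ x, 0 < s x := fun x => Real.sqrt_pos.2 (w0 x)
  have sm : Measurable s := wm.sqrt
  have ss : ∀ x, s x ^ 2 = w x := fun x => Real.sq_sqrt (w0 x).le
  have hS : MemLp (fun x => (s x : ℂ)) 2 μ := by
    rw [memLp_two_iff_integrable_sq_norm (f := fun x => (s x : ℂ))
      (Complex.measurable_ofReal.comp sm).aestronglyMeasurable]
    simpa [ss] using wi
  have sL2 : MemLp s 2 μ := by simpa using hS.re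
  let M : Lp ℂ 2 μ →L[ℂ] Lp ℂ 1 μ := (ContinuousLinearMap.mul ℂ ℂ).holderL μ 2 2 1 hS.toLp
  have hM : ∀ u : Lp ℂ 2 μ, M u =ᵐ[μ] fun x => (s x : ℂ) * u x := fun u => by
    filter_upwards [(ContinuousLinearMap.mul ℂ ℂ).coeFn_holder (r := 1) hS.toLp u,
      hS.coeFn_toLp] with x h1 h2
    rw [ContinuousLinearMap.mul_apply', h2] at h1
    exact h1
  let G : Lp ℂ 2 μ := (InnerProductSpace.toDual ℂ _).symm (Λ.comp M)
  let g₀ : α → ℂ := fun x => starRingEnd ℂ (G x)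
  have hg₀ : StronglyMeasurable g₀ :=
    Complex.continuous_conj.comp_stronglyMeasurable (Lp.stronglyMeasurable G)
  have hg₀L : MemLp g₀ 2 μ := by
    have := (Lp.memLp G).star
    exact this
  have hG : ∀ u : Lp ℂ 2 μ, Λ (M u) = ∫ x, g₀ x * u x ∂μ := fun u => by
    have : inner ℂ G u = Λ (M u) := InnerProductSpace.toDual_symm_apply
    rw [← this, L2.inner_def]
    refine integral_congr_ae (ae_of_all _ fun x => ?_)
    simp [g₀, RCLike.inner_apply, mul_comm]
  have hbound : ∀ᵐ x ∂μ, ‖g₀ x‖ ≤ 2 * (‖Λ‖ * s x) := by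
    refine ae_norm_le_of_norm_setIntegral_le
      (fun E hE hμ => ?_) (fun E hE hμ => ?_) fun E hE hμ => ?_
    · have : IsFiniteMeasure (μ.restrict E) := ⟨by simpa using hμ⟩
      exact (hg₀L.restrict E).integrable (by norm_num)
    · have : IsFiniteMeasure (μ.restrict E) := ⟨by simpa using hμ⟩
      exact ((sL2.restrict E).integrable (by norm_num)).const_mul _
    · have e : ∫ x in E, g₀ x ∂μ = Λ (M (indicatorConstLp 2 hE hμ.ne (1 : ℂ))) := by
        rw [hG, ← integral_indicator hE]
        refine integral_congr_ae ?_
        filter_upwards [indicatorConstLp_coeFn (p := 2) (hs := hE) (hμs := hμ.ne) (c := (1 : ℂ))]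
          with x hx
        rw [hx]; by_cases h : x ∈ E <;> simp [h]
      rw [e, integral_const_mul]
      refine (Λ.le_opNorm _).trans ?_
      gcongr
      rw [norm_L1_eq, ← integral_indicator hE]
      refine le_of_eq (integral_congr_ae ?_)
      filter_upwards [hM (indicatorConstLp 2 hE hμ.ne (1 : ℂ)),
        indicatorConstLp_coeFn (p := 2) (hs := hE) (hμs := hμ.ne) (c := (1 : ℂ))] with x h1 h2
      rw [h1, h2]; by_cases h : x ∈ E <;> simp [h, (s0 x).le]
  classical
  let A : Set α := {x | ‖g₀ x‖ ≤ 2 * (‖Λ‖ * s x)}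
  have hA : MeasurableSet A :=
    measurableSet_le hg₀.measurable.norm ((sm.const_mul _).const_mul _)
  let g : α → ℂ := A.indicator fun x => g₀ x / s x
  have hgm : Measurable g :=
    (hg₀.measurable.div (Complex.measurable_ofReal.comp sm)).indicator hA
  have hgb : ∀ x, ‖g x‖ ≤ 2 * ‖Λ‖ := fun x => by
    by_cases h : x ∈ A
    · simp only [g, Set.indicator_of_mem h, norm_div, Complex.norm_real,
        Real.norm_of_nonneg (s0 x).le]
      rw [div_le_iff₀ (s0 x), mul_assoc]
      exact h
    · simp only [g, Set.indicator_of_notMem h, norm_zero]; positivity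
  have hgs : ∀ᵐ x ∂μ, g₀ x = g x * s x := by
    filter_upwards [hbound] with x hx
    have : (s x : ℂ) ≠ 0 := by exact_mod_cast (s0 x).ne'
    simp only [g, Set.indicator_of_mem (show x ∈ A from hx)]
    field_simp
  refine ⟨g, hgm, hgb, fun f => ?_⟩
  have fi : Integrable f μ := L1.integrable_coeFn f
  let D : ℕ → Set α := fun m => {x | ‖f x‖ ≤ m * w x}
  have hD : ∀ m, MeasurableSet (D m) := fun m =>
    measurableSet_le (Lp.stronglyMeasurable f).measurable.norm (wm.const_mul _)
  let u : ℕ → α → ℂ := fun m => (D m).indicator fun x => f x / s x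
  have hu : ∀ m, MemLp (u m) 2 μ := fun m => by
    have um : Measurable (u m) := ((Lp.stronglyMeasurable f).measurable.div
      (Complex.measurable_ofReal.comp sm)).indicator (hD m)
    rw [memLp_two_iff_integrable_sq_norm um.aestronglyMeasurable]
    refine (fi.norm.const_mul (m : ℝ)).mono' (um.norm.pow_const 2).aestronglyMeasurable
      (ae_of_all _ fun x => ?_)
    by_cases h : x ∈ D m
    · have h' : ‖f x‖ ≤ m * w x := h
      rw [Real.norm_of_nonneg (by positivity)]
      simp only [u, Set.indicator_of_mem h, norm_div, Complex.norm_real,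
        Real.norm_of_nonneg (s0 x).le, div_pow, ss]
      rw [div_le_iff₀ (w0 x)]
      nlinarith [norm_nonneg (f x)]
    · simp only [u, Set.indicator_of_notMem h, norm_zero]; simp; positivity
  have hMu : ∀ m, M (hu m).toLp =ᵐ[μ] (D m).indicator f := fun m => by
    filter_upwards [hM (hu m).toLp, (hu m).coeFn_toLp] with x h1 h2
    have : (s x : ℂ) ≠ 0 := by exact_mod_cast (s0 x).ne'
    rw [h1, h2]
    by_cases h : x ∈ D m
    · simp only [u, Set.indicator_of_mem h]; field_simp
    · simp only [u, Set.indicator_of_notMem h, mul_zero]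
  have hevD : ∀ x, ∀ᶠ m in atTop, x ∈ D m := fun x => by
    obtain ⟨m, hm⟩ := exists_nat_ge (‖f x‖ / w x)
    filter_upwards [eventually_ge_atTop m] with k hk
    rw [div_le_iff₀ (w0 x)] at hm
    refine hm.trans ?_
    have : (m : ℝ) ≤ k := by exact_mod_cast hk
    have := (w0 x).le
    gcongr
  have lim1 : Tendsto (fun m => Λ (M (hu m).toLp)) atTop (𝓝 (Λ f)) := by
    refine (Λ.continuous.tendsto f).comp ?_
    rw [tendsto_iff_norm_sub_tendsto_zero]
    have e : ∀ m, ‖M (hu m).toLp - f‖ = ∫ x, ‖(D m).indicator f x - f x‖ ∂μ := fun m => by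
      rw [norm_L1_eq]
      refine integral_congr_ae ?_
      filter_upwards [hMu m, Lp.coeFn_sub (M (hu m).toLp) f] with x h1 h2
      rw [h2, Pi.sub_apply, h1]
    simp_rw [e]
    have := tendsto_integral_of_dominated_convergence (μ := μ)
      (F := fun m x => ‖(D m).indicator f x - f x‖) (f := fun _ => (0 : ℝ)) (fun x => ‖f x‖)
      (fun m => ((fi.indicator (hD m)).sub fi).norm.aestronglyMeasurable) fi.norm
      (fun m => ae_of_all _ fun x => by by_cases h : x ∈ D m <;> simp [h])
      (ae_of_all _ fun x => by
        refine tendsto_const_nhds.congr' ?_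
        filter_upwards [hevD x] with m hm
        simp [hm])
    simpa using this
  have lim2 : Tendsto (fun m => Λ (M (hu m).toLp)) atTop (𝓝 (∫ x, g x * f x ∂μ)) := by
    have e : ∀ m, Λ (M (hu m).toLp) = ∫ x, (D m).indicator (fun x => g x * f x) x ∂μ := fun m => by
      rw [hG]
      refine integral_congr_ae ?_
      filter_upwards [hgs, (hu m).coeFn_toLp] with x h1 h2
      have : (s x : ℂ) ≠ 0 := by exact_mod_cast (s0 x).ne'
      rw [h1, h2]
      by_cases h : x ∈ D m
      · simp only [u, Set.indicator_of_mem h]; field_simp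
      · simp only [u, Set.indicator_of_notMem h, mul_zero]
    simp_rw [e]
    have gfi : Integrable (fun x => g x * f x) μ :=
      fi.bdd_mul hgm.aestronglyMeasurable (ae_of_all _ hgb)
    refine tendsto_integral_of_dominated_convergence (fun x => ‖g x * f x‖)
      (fun m => (gfi.indicator (hD m)).aestronglyMeasurable) gfi.norm
      (fun m => ae_of_all _ fun x => norm_indicator_le_norm_self _ x) (ae_of_all _ fun x => ?_)
    refine tendsto_const_nhds.congr' ?_
    filter_upwards [hevD x] with m hm
    simp [hm]
  exact tendsto_nhds_unique lim1 lim2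

end Dual

/-! ### The kernel theorem for bounded multilinear forms on `L¹` -/

section Kernel

variable {X : Type*} [MeasurableSpace X] {μ : Measure X} {n : ℕ}

variable (μ) in
/-- Measurable sets of finite measure. -/
abbrev FinMeasSet : Type _ := {E : Set X // MeasurableSet E ∧ μ E ≠ ∞}

/-- The indicator function of a set of finite measure as an element of `L¹`. -/
def ind (E : FinMeasSet μ) : Lp ℂ 1 μ := indicatorConstLp 1 E.2.1 E.2.2 1

lemma coeFn_ind (E : FinMeasSet μ) : ind E =ᵐ[μ] E.1.indicator fun _ => 1 :=
  indicatorConstLp_coeFn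

lemma norm_ind (E : FinMeasSet μ) : ‖ind E‖ = μ.real E.1 := by
  simp [ind, norm_indicatorConstLp]

lemma prod_update_apply (m : Fin n → Lp ℂ 1 μ) (i : Fin n) (v : Lp ℂ 1 μ) (x : Fin n → X) :
    ∏ j, (Function.update m i v j) (x j) = v (x i) * ∏ j ∈ Finset.univ.erase i, m j (x j) := by
  rw [← Finset.mul_prod_erase _ _ (Finset.mem_univ i), Function.update_self]
  congr 1
  refine Finset.prod_congr rfl fun j hj => ?_
  rw [Function.update_of_ne (Finset.ne_of_mem_erase hj)]

variable [SigmaFinite μ]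

lemma integrable_tensor (h : Fin n → Lp ℂ 1 μ) :
    Integrable (fun x : Fin n → X => ∏ i, h i (x i)) (Measure.pi fun _ => μ) :=
  Integrable.fintype_prod fun i => L1.integrable_coeFn (h i)

lemma ae_pi_of_ae {p : X → Prop} (hp : ∀ᵐ x ∂μ, p x) (i : Fin n) :
    ∀ᵐ x : Fin n → X ∂(Measure.pi fun _ => μ), p (x i) :=
  (Measure.tendsto_eval_ae_ae (μ := fun _ : Fin n => μ) (i := i)).eventually hp

variable (μ n) in
/-- The map `(h₁, …, hₙ) ↦ h₁ ⊗ ⋯ ⊗ hₙ` from `L¹(X)ⁿ` to `L¹(Xⁿ)`. -/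
def tensor : ContinuousMultilinearMap ℂ (fun _ : Fin n => Lp ℂ 1 μ)
    (Lp ℂ 1 (Measure.pi fun _ : Fin n => μ)) :=
  MultilinearMap.mkContinuous
    { toFun := fun h => (integrable_tensor h).toL1 _
      map_update_add' := fun {inst} m i a b => by
        obtain rfl := Subsingleton.elim inst (instDecidableEqFin n)
        rw [← Integrable.toL1_add, Integrable.toL1_eq_toL1_iff]
        filter_upwards [ae_pi_of_ae (Lp.coeFn_add a b) i] with x hx
        rw [Pi.add_apply, prod_update_apply, prod_update_apply, prod_update_apply, hx,
          Pi.add_apply, add_mul]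
      map_update_smul' := fun {inst} m i c a => by
        obtain rfl := Subsingleton.elim inst (instDecidableEqFin n)
        rw [← Integrable.toL1_smul', Integrable.toL1_eq_toL1_iff]
        filter_upwards [ae_pi_of_ae (Lp.coeFn_smul c a) i] with x hx
        rw [Pi.smul_apply, prod_update_apply, prod_update_apply, hx,
          Pi.smul_apply, smul_mul_assoc] } 1
    fun h => by
      rw [one_mul]
      refine le_of_eq ?_
      simp only [MultilinearMap.coe_mk, norm_L1_eq]
      rw [← integral_fintype_prod_eq_prod]
      refine integral_congr_ae ?_
      filter_upwards [(integrable_tensor h).coeFn_toL1] with x hx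
      rw [hx, norm_prod]

lemma coeFn_tensor (h : Fin n → Lp ℂ 1 μ) :
    tensor μ n h =ᵐ[Measure.pi fun _ => μ] fun x => ∏ i, h i (x i) :=
  (integrable_tensor h).coeFn_toL1

lemma coeFn_tensor_ind (E : Fin n → FinMeasSet μ) :
    tensor μ n (fun i => ind (E i)) =ᵐ[Measure.pi fun _ => μ]
      (Set.pi Set.univ fun i => (E i).1).indicator fun _ => 1 := by
  have h : ∀ᵐ x : Fin n → X ∂(Measure.pi fun _ => μ), ∀ i,
      ind (E i) (x i) = (E i).1.indicator (fun _ => 1) (x i) :=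
    ae_all_iff.2 fun i => ae_pi_of_ae (coeFn_ind (E i)) i
  filter_upwards [coeFn_tensor fun i => ind (E i), h] with x h1 h2
  rw [h1]
  simp_rw [h2]
  classical
  simp only [Set.indicator_apply, Set.mem_pi, Set.mem_univ, true_implies]
  rw [Finset.prod_ite_zero]
  simp

/-- Integration against a bounded function, as a functional on `L¹`. -/
lemma exists_dual_of_bounded {α : Type*} [MeasurableSpace α] {ν : Measure α} {k : α → ℂ}
    (hk : Measurable k) {C : ℝ} (hC : ∀ x, ‖k x‖ ≤ C) (hC0 : 0 ≤ C) :
    ∃ Λ : Lp ℂ 1 ν →L[ℂ] ℂ, ‖Λ‖ ≤ C ∧ ∀ f, Λ f = ∫ x, k x * f x ∂ν := by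
  have hL : MemLp k ∞ ν := memLp_top_of_bound hk.aestronglyMeasurable C (ae_of_all _ hC)
  have e : ∀ f : Lp ℂ 1 ν, (ContinuousLinearMap.mul ℂ ℂ).lpPairing ν ∞ 1 hL.toLp f =
      ∫ x, k x * f x ∂ν := fun f => by
    rw [ContinuousLinearMap.lpPairing_eq_integral]
    refine integral_congr_ae ?_
    filter_upwards [hL.coeFn_toLp] with x hx
    rw [hx]; rfl
  refine ⟨(ContinuousLinearMap.mul ℂ ℂ).lpPairing ν ∞ 1 hL.toLp, ?_, e⟩
  refine ContinuousLinearMap.opNorm_le_bound _ hC0 fun f => ?_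
  rw [e, norm_L1_eq, ← integral_const_mul]
  have fi : Integrable f ν := L1.integrable_coeFn f
  refine norm_integral_le_of_norm_le (fi.norm.const_mul C) (ae_of_all _ fun x => ?_)
  rw [norm_mul]
  gcongr
  exact hC x

variable {A : MultilinearMap ℂ (fun _ : Fin n => Lp ℂ 1 μ) ℂ} {C : ℝ}

/-- A multilinear form is represented by a bounded function on the products of finitely many
disjoint sets. -/
lemma exists_dual_of_disjoint (hC0 : 0 ≤ C) (hA : ∀ h, ‖A h‖ ≤ C * ∏ i, ‖h i‖)
    {κ : Type*} (s : Finset κ) (Q : κ → FinMeasSet μ)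
    (hQ : ∀ u ∈ s, ∀ v ∈ s, ∀ x, x ∈ (Q u).1 → x ∈ (Q v).1 → u = v) :
    ∃ Λ : Lp ℂ 1 (Measure.pi fun _ : Fin n => μ) →L[ℂ] ℂ, ‖Λ‖ ≤ C ∧
      ∀ r : Fin n → κ, (∀ i, r i ∈ s) →
        Λ (tensor μ n fun i => ind (Q (r i))) = A fun i => ind (Q (r i)) := by
  classical
  let c : (Fin n → κ) → ℂ := fun r =>
    (A fun i => ind (Q (r i))) / ((∏ i, μ.real (Q (r i)).1 : ℝ) : ℂ)
  have hc : ∀ r, ‖c r‖ ≤ C := fun r => by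
    have h0 : 0 ≤ ∏ i, μ.real (Q (r i)).1 := Finset.prod_nonneg fun i _ => measureReal_nonneg
    simp only [c, norm_div, Complex.norm_real, Real.norm_of_nonneg h0]
    refine div_le_of_le_mul₀ h0 hC0 ?_
    simpa only [norm_ind] using hA fun i => ind (Q (r i))
  let box : (Fin n → κ) → Set (Fin n → X) := fun r => Set.pi Set.univ fun i => (Q (r i)).1
  have hbox : ∀ r, MeasurableSet (box r) := fun r =>
    MeasurableSet.univ_pi fun i => (Q (r i)).2.1
  let k : (Fin n → X) → ℂ := fun x =>
    ∑ r ∈ Fintype.piFinset fun _ => s, (box r).indicator (fun _ => c r) x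
  have hk : Measurable k :=
    Finset.measurable_fun_sum _ fun r _ => measurable_const.indicator (hbox r)
  have hk1 : ∀ r ∈ Fintype.piFinset fun _ : Fin n => s, ∀ x ∈ box r, k x = c r :=
    fun r hr x hx => by
    simp only [k]
    rw [Finset.sum_eq_single_of_mem r hr, Set.indicator_of_mem hx]
    intro r' hr' hne
    refine Set.indicator_of_notMem (fun hx' => hne ?_) _
    funext i
    exact hQ _ (Fintype.mem_piFinset.1 hr' i) _ (Fintype.mem_piFinset.1 hr i) (x i)
      (hx' i trivial) (hx i trivial)
  have hkC : ∀ x, ‖k x‖ ≤ C := fun x => by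
    by_cases h : ∃ r ∈ Fintype.piFinset fun _ : Fin n => s, x ∈ box r
    · obtain ⟨r, hr, hx⟩ := h
      rw [hk1 r hr x hx]; exact hc r
    · push Not at h
      have : k x = 0 := Finset.sum_eq_zero fun r hr => Set.indicator_of_notMem (h r hr) _
      rw [this, norm_zero]; exact hC0
  obtain ⟨Λ, hΛ, e⟩ := exists_dual_of_bounded (ν := Measure.pi fun _ : Fin n => μ) hk hkC hC0
  refine ⟨Λ, hΛ, fun r hr => ?_⟩
  have hr : r ∈ Fintype.piFinset fun _ : Fin n => s := Fintype.mem_piFinset.2 hr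
  rw [e]
  have e1 : ∫ x, k x * (tensor μ n fun i => ind (Q (r i))) x ∂(Measure.pi fun _ => μ) =
      ∫ x, (box r).indicator (fun _ => c r) x ∂(Measure.pi fun _ => μ) := by
    refine integral_congr_ae ?_
    filter_upwards [coeFn_tensor_ind fun i => Q (r i)] with x hx
    rw [hx]
    by_cases h : x ∈ box r
    · rw [Set.indicator_of_mem h, Set.indicator_of_mem h, hk1 r hr x h, mul_one]
    · rw [Set.indicator_of_notMem h, Set.indicator_of_notMem h, mul_zero]
  have e2 : (Measure.pi fun _ : Fin n => μ).real (box r) = ∏ i, μ.real (Q (r i)).1 := by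
    simp only [Measure.real, box, Measure.pi_pi, ENNReal.toReal_prod]
  rw [e1, integral_indicator_const _ (hbox r), e2, Complex.real_smul]
  by_cases h0 : ∏ i, μ.real (Q (r i)).1 = 0
  · have := hA fun i => ind (Q (r i))
    simp only [norm_ind, h0, mul_zero] at this
    rw [h0, norm_le_zero_iff.1 this]; simp
  · have : ((∏ i, μ.real (Q (r i)).1 : ℝ) : ℂ) ≠ 0 := by exact_mod_cast h0
    simp only [c]
    field_simp

lemma exists_dual_of_finset (hC0 : 0 ≤ C) (hA : ∀ h, ‖A h‖ ≤ C * ∏ i, ‖h i‖)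
    (T : Finset (FinMeasSet μ)) :
    ∃ Λ : Lp ℂ 1 (Measure.pi fun _ : Fin n => μ) →L[ℂ] ℂ, ‖Λ‖ ≤ C ∧
      ∀ E : Fin n → FinMeasSet μ, (∀ i, E i ∈ T) →
        Λ (tensor μ n fun i => ind (E i)) = A fun i => ind (E i) := by
  classical
  let R : Finset (FinMeasSet μ) → Set X := fun U => {x | ∀ E ∈ T, x ∈ E.1 ↔ E ∈ U}
  have hR : ∀ U, MeasurableSet (R U) := fun U => by
    have : R U = ⋂ E ∈ T, {x | x ∈ E.1 ↔ E ∈ U} := by ext; simp [R]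
    rw [this]
    refine Finset.measurableSet_biInter _ fun E _ => ?_
    by_cases h : E ∈ U
    · simpa [h] using E.2.1
    · simp only [h, iff_false]
      exact E.2.1.compl
  let Q : Finset (FinMeasSet μ) → FinMeasSet μ := fun U =>
    if h : ∃ E ∈ T, E ∈ U then ⟨R U, hR U, by
      obtain ⟨E, hE, hEU⟩ := h
      exact ne_top_of_le_ne_top E.2.2 (measure_mono fun x hx => (hx E hE).2 hEU)⟩
    else ⟨∅, MeasurableSet.empty, by simp⟩
  have hQ : ∀ U, ∀ x ∈ (Q U).1, x ∈ R U := fun U x hx => by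
    by_cases h : ∃ E ∈ T, E ∈ U
    · simpa only [Q, dif_pos h] using hx
    · simp only [Q, dif_neg h, Set.mem_empty_iff_false] at hx
  have hQ' : ∀ U, (∃ E ∈ T, E ∈ U) → (Q U).1 = R U := fun U h => by simp only [Q, dif_pos h]
  obtain ⟨Λ, hΛ, e⟩ := exists_dual_of_disjoint hC0 hA T.powerset Q (fun U hU V hV x hxU hxV => by
    ext E
    by_cases hE : E ∈ T
    · rw [← hQ U x hxU E hE, hQ V x hxV E hE]
    · exact ⟨fun h => (hE (Finset.mem_powerset.1 hU h)).elim,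
        fun h => (hE (Finset.mem_powerset.1 hV h)).elim⟩)
  refine ⟨Λ, hΛ, fun E hE => ?_⟩
  have hind : ∀ i, ind (E i) = ∑ U ∈ T.powerset.filter (E i ∈ ·), ind (Q U) := fun i => by
    apply Lp.ext
    have h1 : ∀ᵐ x ∂μ, ∀ U ∈ T.powerset, ind (Q U) x = (Q U).1.indicator (fun _ => 1) x :=
      (Finset.eventually_all _).2 fun U _ => coeFn_ind (Q U)
    filter_upwards [coeFn_ind (E i), Lp.coeFn_finsetSum (T.powerset.filter (E i ∈ ·))
      (fun U => ind (Q U)), h1] with x hx1 hx2 hx3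
    rw [hx1, hx2, Finset.sum_apply,
      Finset.sum_congr rfl fun U hU => hx3 U (Finset.mem_filter.1 hU).1]
    by_cases hx : x ∈ (E i).1
    · have hm : T.filter (x ∈ ·.1) ∈ T.powerset.filter (E i ∈ ·) := by
        simp [hE i, hx]
      rw [Set.indicator_of_mem hx, Finset.sum_eq_single_of_mem _ hm, Set.indicator_of_mem]
      · rw [hQ' _ ⟨E i, hE i, by simp [hE i, hx]⟩]
        intro F hF
        simp [hF]
      · intro U hU hne
        refine Set.indicator_of_notMem (fun hxU => hne ?_) _
        ext F
        by_cases hF : F ∈ T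
        · simp [hF, hQ U x hxU F hF]
        · simp only [Finset.mem_filter, hF, false_and, iff_false]
          exact fun h => hF (Finset.mem_powerset.1 (Finset.mem_filter.1 hU).1 h)
    · rw [Set.indicator_of_notMem hx, Finset.sum_eq_zero]
      intro U hU
      exact Set.indicator_of_notMem (fun hxU =>
        hx ((hQ U x hxU (E i) (hE i)).2 (Finset.mem_filter.1 hU).2)) _
  simp_rw [hind]
  rw [A.map_sum_finset, ContinuousMultilinearMap.map_sum_finset, map_sum]
  refine Finset.sum_congr rfl fun r hr => e r fun i => ?_
  exact (Finset.mem_filter.1 (Fintype.mem_piFinset.1 hr i)).1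

/-- A bounded multilinear form on `L¹(X)` extends to a functional on `L¹(Xⁿ)`. -/
lemma exists_dual_of_multilinear (hC0 : 0 ≤ C) (hA : ∀ h, ‖A h‖ ≤ C * ∏ i, ‖h i‖) :
    ∃ Λ : Lp ℂ 1 (Measure.pi fun _ : Fin n => μ) →L[ℂ] ℂ, ‖Λ‖ ≤ C ∧
      ∀ h : Fin n → Lp ℂ 1 μ, Λ (tensor μ n h) = A h := by
  classical
  choose Φ hΦ hΦA using exists_dual_of_finset hC0 hA
  have hK := WeakDual.isCompact_closedBall (𝕜 := ℂ)
    (0 : StrongDual ℂ (Lp ℂ 1 (Measure.pi fun _ : Fin n => μ))) C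
  obtain ⟨Λ', hΛK, hΛ⟩ := hK (f := map (fun T => StrongDual.toWeakDual (Φ T)) atTop)
    (by
      rw [le_principal_iff, mem_map]
      refine univ_mem' fun T => ?_
      simpa using hΦ T)
  let Λ := WeakDual.toStrongDual Λ'
  refine ⟨Λ, by simpa using hΛK, ?_⟩
  have hind : ∀ E : Fin n → FinMeasSet μ,
      Λ (tensor μ n fun i => ind (E i)) = A fun i => ind (E i) := fun E => by
    let S : Set (WeakDual ℂ (Lp ℂ 1 (Measure.pi fun _ : Fin n => μ))) :=
      {L | L (tensor μ n fun i => ind (E i)) = A fun i => ind (E i)}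
    have hS : IsClosed S :=
      isClosed_eq (WeakDual.eval_continuous _) continuous_const
    have hle : map (fun T => StrongDual.toWeakDual (Φ T)) atTop ≤ 𝓟 S := by
      rw [le_principal_iff, mem_map]
      filter_upwards [eventually_ge_atTop (Finset.univ.image E)] with T hT
      exact hΦA T E fun i => hT (Finset.mem_image_of_mem _ (Finset.mem_univ i))
    have := mem_closure_iff_clusterPt.2 (hΛ.mono hle)
    rw [hS.closure_eq] at this
    exact this
  let Ac : ContinuousMultilinearMap ℂ (fun _ : Fin n => Lp ℂ 1 μ) ℂ := A.mkContinuous C hA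
  have key : ∀ s : Finset (Fin n), ∀ h : Fin n → Lp ℂ 1 μ,
      (∀ i ∉ s, ∃ E, h i = ind E) → Λ (tensor μ n h) = Ac h := by
    intro s
    induction s using Finset.induction_on with
    | empty =>
      intro h hh
      choose E hE using fun i => hh i (Finset.notMem_empty i)
      obtain rfl : h = fun i => ind (E i) := funext hE
      exact hind E
    | insert i s _ ih =>
      intro h hh
      have : ∀ v : Lp ℂ 1 μ,
          Λ (tensor μ n (Function.update h i v)) = Ac (Function.update h i v) := by
        intro v
        refine Lp.induction ENNReal.one_ne_top (motive := fun v =>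
          Λ (tensor μ n (Function.update h i v)) = Ac (Function.update h i v)) ?_ ?_ ?_ v
        · intro c t ht hμt
          have e : (Lp.simpleFunc.indicatorConst 1 ht hμt.ne c : Lp ℂ 1 μ) =
              c • ind ⟨t, ht, hμt.ne⟩ := by
            rw [Lp.simpleFunc.coe_indicatorConst]
            apply Lp.ext
            filter_upwards [indicatorConstLp_coeFn (p := 1) (hs := ht) (hμs := hμt.ne) (c := c),
              Lp.coeFn_smul c (ind (μ := μ) ⟨t, ht, hμt.ne⟩),
              coeFn_ind (μ := μ) ⟨t, ht, hμt.ne⟩] with x h1 h2 h3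
            rw [h1, h2, Pi.smul_apply, h3]
            by_cases hx : x ∈ t <;> simp [hx]
          rw [e, ContinuousMultilinearMap.map_update_smul, ContinuousMultilinearMap.map_update_smul,
            map_smul, ih]
          intro j hj
          rcases eq_or_ne j i with rfl | hji
          · exact ⟨_, Function.update_self ..⟩
          · rw [Function.update_of_ne hji]
            exact hh j (by simp [hj, hji])
        · intro f g hf hg _ h1 h2
          rw [ContinuousMultilinearMap.map_update_add, ContinuousMultilinearMap.map_update_add,
            map_add, h1, h2]
        · have hc : Continuous fun v : Lp ℂ 1 μ => Function.update h i v :=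
            continuous_const.update i continuous_id
          exact isClosed_eq (Λ.continuous.comp ((tensor μ n).cont.comp hc)) (Ac.cont.comp hc)
      simpa using this (h i)
  exact fun h => key Finset.univ h fun i hi => (hi (Finset.mem_univ i)).elim

/-- The kernel theorem: a bounded multilinear form on `L¹` is given by a bounded function. -/
theorem exists_kernel (hC0 : 0 ≤ C) (hA : ∀ h, ‖A h‖ ≤ C * ∏ i, ‖h i‖) :
    ∃ k : (Fin n → X) → ℂ, Measurable k ∧ (∀ x, ‖k x‖ ≤ 2 * C) ∧
      ∀ h : Fin n → Lp ℂ 1 μ, A h = ∫ x, k x * ∏ i, h i (x i) ∂(Measure.pi fun _ => μ) := by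
  obtain ⟨Λ, hΛ, e⟩ := exists_dual_of_multilinear hC0 hA
  obtain ⟨k, hk, hkb, hkΛ⟩ := exists_bounded_of_dual_L1 Λ
  refine ⟨k, hk, fun x => (hkb x).trans (by linarith), fun h => ?_⟩
  rw [← e, hkΛ]
  refine integral_congr_ae ?_
  filter_upwards [coeFn_tensor h] with x hx
  rw [hx]

end Kernel

/-! ### Integration with respect to the Lebesgue–Poisson measure -/

section LebesguePoisson

variable {d : ℕ}

open Classical in
/-- The configuration of the points of a tuple (empty if the points are not distinct). -/
def cfg (d n : ℕ) (x : Fin n → Space d) : FinConfig d :=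
  if h : Function.Injective x then symm d n ⟨x, h⟩ else ⟨∅⟩

lemma cfg_of_injective {n : ℕ} {x : Fin n → Space d} (h : Function.Injective x) :
    cfg d n x = symm d n ⟨x, h⟩ := dif_pos h

lemma measurable_finConfig_iff {β : Type*} [MeasurableSpace β] {F : FinConfig d → β} :
    Measurable F ↔ ∀ n, Measurable fun x => F (symm d n x) := by
  constructor
  · intro hF n s hs
    have := hF hs
    rw [MeasurableSpace.measurableSet_iInf] at this
    exact this n
  · intro hF s hs
    rw [MeasurableSpace.measurableSet_iInf]
    exact fun n => hF n hs

lemma measurable_symm (d n : ℕ) : Measurable (symm d n) :=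
  measurable_finConfig_iff.1 measurable_id n

lemma measurableSet_injective (d n : ℕ) :
    MeasurableSet {x : Fin n → Space d | Function.Injective x} := by
  have : {x : Fin n → Space d | Function.Injective x} =
      ⋂ i, ⋂ j, {x | x i = x j → i = j} := by ext; simp [Function.Injective]
  rw [this]
  refine MeasurableSet.iInter fun i => MeasurableSet.iInter fun j => ?_
  by_cases h : i = j
  · simp [h]
  · simp only [h, imp_false]
    exact (measurableSet_eq_fun (measurable_pi_apply i) (measurable_pi_apply j)).compl

lemma measurable_cfg (d n : ℕ) : Measurable (cfg d n) :=
  Measurable.dite (s := {x : Fin n → Space d | Function.Injective x}) (f := symm d n)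
    (g := fun _ => ⟨∅⟩) (measurable_symm d n) measurable_const (measurableSet_injective d n)

lemma ae_injective (hd : 0 < d) (n : ℕ) : ∀ᵐ x : Fin n → Space d, Function.Injective x := by
  have : ∀ i j : Fin n, ∀ᵐ x : Fin n → Space d, x i = x j → i = j := fun i j => by
    by_cases h : i = j
    · simp [h]
    let S : Submodule ℝ (Fin n → Space d) :=
      LinearMap.ker (LinearMap.proj (R := ℝ) (φ := fun _ : Fin n => Space d) i -
        LinearMap.proj (R := ℝ) (φ := fun _ : Fin n => Space d) j)
    have hS : S ≠ ⊤ := by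
      intro hS
      have : (Pi.single i (EuclideanSpace.single ⟨0, hd⟩ (1 : ℝ)) : Fin n → Space d) ∈ S := by
        rw [hS]; trivial
      simp only [S, LinearMap.mem_ker, LinearMap.sub_apply, LinearMap.proj_apply, Pi.single_eq_same,
        Pi.single_eq_of_ne (Ne.symm h), sub_zero] at this
      simpa using congrArg (fun v : Space d => v ⟨0, hd⟩) this
    have h0 := Measure.addHaar_submodule (volume : Measure (Fin n → Space d)) S hS
    rw [ae_iff]
    refine measure_mono_null (fun x hx => ?_) h0
    simp only [Set.mem_ofPred_eq, Classical.not_imp] at hx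
    simp [S, hx.1]
  filter_upwards [ae_all_iff.2 fun i => ae_all_iff.2 (this i)] with x hx i j hij
  exact hx i j hij

lemma lebesguePoisson_eq (hd : 0 < d) : lebesguePoisson d = Measure.sum fun n : ℕ =>
    ((n.factorial : ℝ≥0∞))⁻¹ • Measure.map (cfg d n) volume := by
  unfold lebesguePoisson
  congr 1
  funext n
  congr 1
  have e : symm d n = cfg d n ∘ Subtype.val := funext fun x => (cfg_of_injective x.2).symm
  have h : Measure.map (Subtype.val : {x : Fin n → Space d // Function.Injective x} → _)
      (Measure.comap Subtype.val volume) = volume :=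
    ((MeasurableEmbedding.subtype_coe (measurableSet_injective d n)).map_comap volume).trans <| by
      refine Measure.restrict_eq_self_of_ae_mem ?_
      filter_upwards [ae_injective hd n] with x hx
      exact ⟨⟨x, hx⟩, rfl⟩
  rw [e, ← Measure.map_map (measurable_cfg d n) measurable_subtype_coe, h]

lemma lintegral_lebesguePoisson (hd : 0 < d) {F : FinConfig d → ℝ≥0∞} (hF : Measurable F) :
    ∫⁻ η, F η ∂(lebesguePoisson d) =
      ∑' n : ℕ, (n.factorial : ℝ≥0∞)⁻¹ * ∫⁻ x, F (cfg d n x) := by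
  rw [lebesguePoisson_eq hd, lintegral_sum_measure]
  refine tsum_congr fun n => ?_
  rw [lintegral_smul_measure, lintegral_map hF (measurable_cfg d n), smul_eq_mul]

lemma measurable_comp_cfg {F : FinConfig d → ℂ} (hF : Measurable F) (n : ℕ) :
    Measurable fun x => F (cfg d n x) := hF.comp (measurable_cfg d n)

lemma ae_lebesguePoisson_of_ae (hd : 0 < d) {p : FinConfig d → Prop} (hp : MeasurableSet {η | p η})
    (h : ∀ n, ∀ᵐ x, p (cfg d n x)) : ∀ᵐ η ∂(lebesguePoisson d), p η := by
  rw [lebesguePoisson_eq hd, Measure.ae_sum_iff]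
  intro n
  refine Measure.ae_smul_measure ?_ _
  rw [ae_map_iff (measurable_cfg d n).aemeasurable hp]
  exact h n

lemma ae_cfg_of_ae (hd : 0 < d) {p : FinConfig d → Prop}
    (h : ∀ᵐ η ∂(lebesguePoisson d), p η) (n : ℕ) : ∀ᵐ x, p (cfg d n x) := by
  rw [lebesguePoisson_eq hd, Measure.ae_sum_iff] at h
  have h' : ∀ᵐ η ∂(Measure.map (cfg d n) volume), p η := by
    have := h n
    rw [ae_iff, Measure.smul_apply, smul_eq_mul, mul_eq_zero] at this
    exact this.resolve_left (by simp)
  exact ae_of_ae_map (measurable_cfg d n).aemeasurable h'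

lemma hasSum_integral_lebesguePoisson (hd : 0 < d) {F : FinConfig d → ℂ}
    (hF : Measurable F) (hi : Integrable F (lebesguePoisson d)) :
    HasSum (fun n : ℕ => (n.factorial : ℂ)⁻¹ * ∫ x, F (cfg d n x))
      (∫ η, F η ∂(lebesguePoisson d)) := by
  rw [lebesguePoisson_eq hd] at hi ⊢
  refine (hasSum_integral_measure hi).congr_fun ?_
  intro n
  rw [integral_smul_measure, integral_map (measurable_cfg d n).aemeasurable
    hF.aestronglyMeasurable]
  simp

lemma integrable_comp_cfg (hd : 0 < d) {F : FinConfig d → ℂ} (hF : Measurable F)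
    (hi : Integrable F (lebesguePoisson d)) (n : ℕ) : Integrable fun x => F (cfg d n x) := by
  rw [lebesguePoisson_eq hd] at hi
  have h1 := hi.mono_measure (Measure.le_sum _ n)
  rw [integrable_smul_measure (by simp) (by simp [n.factorial_ne_zero])] at h1
  exact (integrable_map_measure hF.aestronglyMeasurable (measurable_cfg d n).aemeasurable).1 h1

lemma integrable_lebesguePoisson (hd : 0 < d) {F : FinConfig d → ℂ} (hF : Measurable F)
    {b : ℕ → ℝ} (hb : Summable b) (hi : ∀ n, Integrable fun x => F (cfg d n x))
    (h : ∀ n : ℕ, (n.factorial : ℝ)⁻¹ * ∫ x, ‖F (cfg d n x)‖ ≤ b n) :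
    Integrable F (lebesguePoisson d) := by
  refine ⟨hF.aestronglyMeasurable, ?_⟩
  have hb0 : ∀ n, 0 ≤ b n := fun n => le_trans (by positivity) (h n)
  rw [hasFiniteIntegral_iff_enorm, lintegral_lebesguePoisson hd hF.enorm]
  have e : ∀ n : ℕ, (n.factorial : ℝ≥0∞)⁻¹ * ∫⁻ x, ‖F (cfg d n x)‖ₑ ≤ ENNReal.ofReal (b n) := by
    intro n
    rw [← ofReal_integral_norm_eq_lintegral_enorm (hi n)]
    have h1 : (n.factorial : ℝ≥0∞)⁻¹ = ENNReal.ofReal ((n.factorial : ℝ)⁻¹) := by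
      rw [ENNReal.ofReal_inv_of_pos (by exact_mod_cast n.factorial_pos), ENNReal.ofReal_natCast]
    rw [h1, ← ENNReal.ofReal_mul (by positivity)]
    exact ENNReal.ofReal_le_ofReal (h n)
  refine (ENNReal.tsum_le_tsum e).trans_lt ?_
  rw [← ENNReal.ofReal_tsum_of_nonneg hb0 hb]
  exact ENNReal.ofReal_lt_top

lemma coherent_symm (f : Space d → ℂ) {n : ℕ}
    (x : {x : Fin n → Space d // Function.Injective x}) :
    coherent f (symm d n x) = ∏ i, f (x.1 i) := by
  simp [coherent, symm]

lemma coherent_cfg (f : Space d → ℂ) {n : ℕ} {x : Fin n → Space d} (h : Function.Injective x) :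
    coherent f (cfg d n x) = ∏ i, f (x i) := by
  rw [cfg_of_injective h, coherent_symm]

lemma measurable_coherent {f : Space d → ℂ} (hf : Measurable f) : Measurable (coherent f) := by
  rw [measurable_finConfig_iff]
  intro n
  simp_rw [coherent_symm]
  exact Finset.measurable_fun_prod _ fun i _ =>
    hf.comp ((measurable_pi_apply i).comp measurable_subtype_coe)

lemma card_cfg {n : ℕ} {x : Fin n → Space d} (h : Function.Injective x) :
    (cfg d n x).points.card = n := by
  rw [cfg_of_injective h]; simp [symm]

lemma cfg_comp_perm {n : ℕ} (x : Fin n → Space d) (σ : Equiv.Perm (Fin n)) :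
    cfg d n (x ∘ σ) = cfg d n x := by
  by_cases h : Function.Injective x
  · have h' : Function.Injective (x ∘ σ) := h.comp σ.injective
    rw [cfg_of_injective h, cfg_of_injective h']
    ext p
    simp only [symm, Finset.mem_map, Finset.mem_univ, true_and, Function.Embedding.coeFn_mk,
      Function.comp]
    exact ⟨fun ⟨i, hi⟩ => ⟨σ i, hi⟩, fun ⟨i, hi⟩ => ⟨σ.symm i, by simpa using hi⟩⟩
  · have h' : ¬ Function.Injective (x ∘ σ) := fun h' => h (by
      have := h'.comp σ.symm.injective
      simpa [Function.comp_assoc] using this)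
    simp [cfg, h, h']

/-- The function on configurations given by a family of symmetric functions of tuples. -/
def ofSymmetric (κ : ∀ n : ℕ, (Fin n → Space d) → ℂ) (η : FinConfig d) : ℂ :=
  κ η.points.card fun i => (η.points.equivFin.symm i : Space d)

lemma ofSymmetric_symm {κ : ∀ n : ℕ, (Fin n → Space d) → ℂ}
    (hκ : ∀ n (σ : Equiv.Perm (Fin n)) x, κ n (x ∘ σ) = κ n x) {n : ℕ}
    (x : {x : Fin n → Space d // Function.Injective x}) :
    ofSymmetric κ (symm d n x) = κ n x.1 := by
  have key : ∀ (η : FinConfig d) (m : ℕ) (e : Fin m ≃ η.points),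
      ofSymmetric κ η = κ m fun i => (e i : Space d) := fun η m e => by
    obtain rfl : m = η.points.card := by simpa using Fintype.card_congr e
    rw [ofSymmetric, ← hκ _ (e.trans η.points.equivFin)]
    congr 1
    funext i
    simp
  let η := symm d n x
  have hmem : ∀ i, x.1 i ∈ η.points := fun i => by simp [η, symm]
  let e : Fin n ≃ η.points := Equiv.ofBijective (fun i => ⟨x.1 i, hmem i⟩)
    ⟨fun i j h => x.2 (by simpa using h), fun ⟨p, hp⟩ => by
      simpa [η, symm, Subtype.ext_iff] using hp⟩
  exact key η n e

lemma measurable_ofSymmetric {κ : ∀ n : ℕ, (Fin n → Space d) → ℂ}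
    (hκ : ∀ n (σ : Equiv.Perm (Fin n)) x, κ n (x ∘ σ) = κ n x) (hm : ∀ n, Measurable (κ n)) :
    Measurable (ofSymmetric κ) := by
  rw [measurable_finConfig_iff]
  intro n
  simp_rw [ofSymmetric_symm hκ]
  exact (hm n).comp measurable_subtype_coe

end LebesguePoisson

/-! ### Uniqueness of the correlation function -/

section Uniqueness

/-- Ryser's formula: the polarization identity for products of linear forms. -/
lemma sum_neg_one_pow_mul_prod_sum {R : Type*} [CommRing R] {n : ℕ} (a : Fin n → Fin n → R) :
    ∑ T : Finset (Fin n), (-1) ^ T.card * ∏ i, ∑ j ∈ Tᶜ, a i j =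
      ∑ σ : Equiv.Perm (Fin n), ∏ i, a i (σ i) := by
  classical
  have h1 : ∀ T : Finset (Fin n), (-1) ^ T.card * ∏ i, ∑ j ∈ Tᶜ, a i j =
      ∑ f : Fin n → Fin n, if T ⊆ (Finset.univ.image f)ᶜ then
        (-1) ^ T.card * ∏ i, a i (f i) else 0 := fun T => by
    rw [Finset.prod_univ_sum, Finset.mul_sum, ← Finset.sum_filter]
    refine Finset.sum_congr ?_ fun _ _ => rfl
    ext f
    simp only [Fintype.mem_piFinset, Finset.mem_compl, Finset.mem_filter, Finset.mem_univ,
      true_and, Finset.subset_iff, Finset.mem_image, not_exists]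
    exact ⟨fun h x hx i hi => h i (hi ▸ hx), fun h i hi => h hi i rfl⟩
  rw [Finset.sum_congr rfl fun T _ => h1 T, Finset.sum_comm]
  symm
  refine Finset.sum_of_injOn (fun σ : Equiv.Perm (Fin n) => (σ : Fin n → Fin n))
    (fun σ _ τ _ h => Equiv.coe_fn_injective h) (fun _ _ => by simp) (fun f _ hf => ?_)
    fun σ _ => ?_
  · rw [← Finset.sum_filter, ← Finset.sum_mul]
    have : (Finset.univ.filter fun T : Finset (Fin n) => T ⊆ (Finset.univ.image f)ᶜ) =
        ((Finset.univ.image f)ᶜ).powerset := by ext; simp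
    have hne : (Finset.univ.image f)ᶜ ≠ ∅ := fun h => hf (by
      have hs : Function.Surjective f := fun y => by
        have : y ∈ Finset.univ.image f := by
          rw [← compl_compl (Finset.univ.image f), h]; simp
        simpa using this
      exact ⟨Equiv.ofBijective f ⟨Finite.injective_iff_surjective.2 hs, hs⟩, by simp, rfl⟩)
    have h0 := Finset.sum_powerset_neg_one_pow_card (x := (Finset.univ.image f)ᶜ)
    rw [if_neg hne] at h0
    rw [this]
    have h0' : (∑ m ∈ ((Finset.univ.image f)ᶜ).powerset, (-1 : R) ^ m.card) = 0 := by
      exact_mod_cast congrArg (Int.cast : ℤ → R) h0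
    rw [h0', zero_mul]
  · have : (Finset.univ.image σ)ᶜ = ∅ := by
      rw [Finset.image_univ_of_surjective σ.surjective, Finset.compl_univ]
    rw [this]
    simp only [Finset.subset_empty]
    rw [Finset.sum_ite_eq' Finset.univ ∅]
    simp

lemma eq_zero_of_hasSum_pow {c : ℕ → ℂ} (h : ∀ w : ℂ, HasSum (fun n => w ^ n * c n) 0) (n : ℕ) :
    c n = 0 := by
  let p : FormalMultilinearSeries ℂ ℂ ℂ := FormalMultilinearSeries.ofScalars ℂ c
  have hp : HasFPowerSeriesOnBall (fun _ : ℂ => (0 : ℂ)) p 0 1 :=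
    { r_le := by
        refine p.le_radius_of_summable_norm ?_
        have := (h 1).summable.norm
        simpa [p, FormalMultilinearSeries.ofScalars_norm] using this
      r_pos := one_pos
      hasSum := fun {y} _ => by
        have := h y
        simp only [p, FormalMultilinearSeries.ofScalars_apply_eq]
        simpa [mul_comm] using this }
  have h0 := hp.hasFPowerSeriesAt.eq_zero
  have := congrArg (fun q : FormalMultilinearSeries ℂ ℂ ℂ => q.coeff n) h0
  simp only [p, FormalMultilinearSeries.coeff_ofScalars] at this
  rw [this]
  rfl

variable {d : ℕ}

lemma integral_comp_perm {n : ℕ} (σ : Equiv.Perm (Fin n)) (F : (Fin n → Space d) → ℂ) :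
    ∫ x, F (x ∘ σ) = ∫ x, F x := by
  have := (volume_preserving_arrowCongr' σ.symm (MeasurableEquiv.refl (Space d))
    (MeasurePreserving.id _)).integral_comp' F
  exact this

/-- A symmetric function with vanishing integrals against all `θ ⊗ ⋯ ⊗ θ` vanishes. -/
lemma setIntegral_pi_eq_zero {n : ℕ} {v : (Fin n → Space d) → ℂ}
    (hsymm : ∀ (σ : Equiv.Perm (Fin n)) x, v (x ∘ σ) = v x)
    (hi : ∀ θ : L1 d, Integrable fun x : Fin n → Space d => (∏ i, θ (x i)) * v x)
    (h0 : ∀ θ : L1 d, ∫ x : Fin n → Space d, (∏ i, θ (x i)) * v x = 0)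
    (hv : Measurable v) (E : Fin n → FinMeasSet (volume : Measure (Space d))) :
    IntegrableOn v (Set.pi Set.univ fun i => (E i).1) ∧
      ∫ x in Set.pi Set.univ fun i => (E i).1, v x = 0 := by
  classical
  let χ : Fin n → Space d → ℂ := fun j => (E j).1.indicator fun _ => 1
  have hχm : ∀ j, Measurable (χ j) := fun j => measurable_const.indicator (E j).2.1
  let θ : Finset (Fin n) → L1 d := fun T => ∑ j ∈ Tᶜ, ind (E j)
  have hθ : ∀ T, ∀ᵐ y : Space d, θ T y = ∑ j ∈ Tᶜ, χ j y := fun T => by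
    have h1 : ∀ᵐ y : Space d, ∀ j, ind (E j) y = χ j y := ae_all_iff.2 fun j => coeFn_ind (E j)
    filter_upwards [h1, Lp.coeFn_finsetSum Tᶜ fun j => ind (E j)] with y hy1 hy2
    rw [hy2, Finset.sum_apply]
    exact Finset.sum_congr rfl fun j _ => hy1 j
  have hθn : ∀ T, (fun x : Fin n → Space d => (∏ i, θ T (x i)) * v x) =ᵐ[volume]
      fun x => (∏ i, ∑ j ∈ Tᶜ, χ j (x i)) * v x := fun T => by
    have : ∀ᵐ x : Fin n → Space d, ∀ i, θ T (x i) = ∑ j ∈ Tᶜ, χ j (x i) :=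
      ae_all_iff.2 fun i => ae_pi_of_ae (hθ T) i
    filter_upwards [this] with x hx
    simp_rw [hx]
  have hiT := fun T => (hi (θ T)).congr (hθn T)
  have h0T := fun T => (integral_congr_ae (hθn T)).symm.trans (h0 (θ T))
  have hiσ : ∀ σ : Equiv.Perm (Fin n),
      Integrable fun x : Fin n → Space d => (∏ i, χ (σ i) (x i)) * v x := fun σ => by
    refine (hiT ∅).mono ((Finset.measurable_fun_prod _ fun i _ => (hχm _).comp
      (measurable_pi_apply i)).mul hv).aestronglyMeasurable (ae_of_all _ fun x => ?_)
    rw [norm_mul, norm_mul, norm_prod, norm_prod]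
    gcongr with i
    have e1 : ∀ j y, χ j y = (((E j).1.indicator (fun _ => (1 : ℝ)) y : ℝ) : ℂ) := fun j y => by
      by_cases hy : y ∈ (E j).1 <;> simp [χ, hy]
    have e0 : ∀ j y, 0 ≤ (E j).1.indicator (fun _ => (1 : ℝ)) y := fun j y =>
      Set.indicator_nonneg (fun _ _ => zero_le_one) y
    simp_rw [e1]
    rw [← Complex.ofReal_sum, Complex.norm_real, Complex.norm_real, Real.norm_of_nonneg (e0 _ _),
      Real.norm_of_nonneg (Finset.sum_nonneg fun j _ => e0 _ _)]
    exact Finset.single_le_sum (f := fun j => (E j).1.indicator (fun _ => (1 : ℝ)) (x i))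
      (fun j _ => e0 _ _) (by simp)
  have hσ : ∀ σ : Equiv.Perm (Fin n), ∫ x : Fin n → Space d, (∏ i, χ (σ i) (x i)) * v x =
      ∫ x : Fin n → Space d, (∏ i, χ i (x i)) * v x := fun σ => by
    rw [← integral_comp_perm σ⁻¹ fun x => (∏ i, χ i (x i)) * v x]
    refine integral_congr_ae (ae_of_all _ fun x => ?_)
    simp only [hsymm]
    rw [← Equiv.prod_comp σ fun i => χ i ((x ∘ ⇑σ⁻¹) i)]
    simp
  have hsum : ∑ σ : Equiv.Perm (Fin n), ∫ x : Fin n → Space d, (∏ i, χ (σ i) (x i)) * v x = 0 := by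
    rw [← integral_finsetSum _ fun σ _ => hiσ σ]
    have e : ∀ x : Fin n → Space d, ∑ σ : Equiv.Perm (Fin n), (∏ i, χ (σ i) (x i)) * v x =
        ∑ T : Finset (Fin n), (-1) ^ T.card * ((∏ i, ∑ j ∈ Tᶜ, χ j (x i)) * v x) := fun x => by
      rw [← Finset.sum_mul, ← sum_neg_one_pow_mul_prod_sum fun i j => χ j (x i), Finset.sum_mul]
      simp_rw [mul_assoc]
    simp_rw [e]
    rw [integral_finsetSum _ fun T _ => (hiT T).const_mul _]
    refine Finset.sum_eq_zero fun T _ => ?_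
    rw [integral_const_mul, h0T, mul_zero]
  have hbox : MeasurableSet (Set.pi Set.univ fun i => (E i).1) :=
    MeasurableSet.univ_pi fun i => (E i).2.1
  have eχ : (fun x : Fin n → Space d => (∏ i, χ i (x i)) * v x) =
      (Set.pi Set.univ fun i => (E i).1).indicator v := by
    funext x
    simp only [χ, Set.indicator_apply, Set.mem_pi, Set.mem_univ, true_implies]
    rw [Finset.prod_ite_zero]
    simp
  constructor
  · rw [← integrable_indicator_iff hbox, ← eχ]
    exact hiσ 1
  · rw [← integral_indicator hbox, ← eχ]
    simp_rw [hσ] at hsum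
    simpa [Finset.card_univ, Fintype.card_perm, Nat.factorial_ne_zero] using hsum

lemma ae_eq_zero_of_symmetric {n : ℕ} {v : (Fin n → Space d) → ℂ}
    (hsymm : ∀ (σ : Equiv.Perm (Fin n)) x, v (x ∘ σ) = v x)
    (hi : ∀ θ : L1 d, Integrable fun x : Fin n → Space d => (∏ i, θ (x i)) * v x)
    (h0 : ∀ θ : L1 d, ∫ x : Fin n → Space d, (∏ i, θ (x i)) * v x = 0)
    (hv : Measurable v) : ∀ᵐ x, v x = 0 := by
  have key : ∀ R : ℕ, ∀ᵐ x, x ∈ (Set.pi Set.univ fun _ : Fin n =>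
      Metric.closedBall (0 : Space d) R) → v x = 0 := fun R => by
    let K : FinMeasSet (volume : Measure (Space d)) :=
      ⟨Metric.closedBall 0 R, measurableSet_closedBall, measure_closedBall_lt_top.ne⟩
    let Kn : Set (Fin n → Space d) := Set.pi Set.univ fun _ => K.1
    have hKn : MeasurableSet Kn := MeasurableSet.univ_pi fun _ => K.2.1
    have hvK : IntegrableOn v Kn := (setIntegral_pi_eq_zero hsymm hi h0 hv fun _ => K).1
    have hall : ∀ s, MeasurableSet s → ∫ x in s, v x ∂(volume.restrict Kn) = 0 := by
      intro s hs
      refine MeasurableSpace.induction_on_inter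
        (C := fun s _ => ∫ x in s, v x ∂(volume.restrict Kn) = 0) (generateFrom_pi).symm
        isPiSystem_pi (by simp) ?_ ?_ ?_ s hs
      · rintro _ ⟨t, ht, rfl⟩
        have ht' : ∀ i, MeasurableSet (t i) := fun i => ht i trivial
        have := (setIntegral_pi_eq_zero hsymm hi h0 hv fun i =>
          ⟨t i ∩ K.1, (ht' i).inter K.2.1,
            ne_top_of_le_ne_top K.2.2 (measure_mono Set.inter_subset_right)⟩).2
        rw [Measure.restrict_restrict (MeasurableSet.univ_pi ht'), ← Set.pi_inter_distrib]
        exact this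
      · intro t ht ih
        have h1 := integral_add_compl ht hvK
        rw [ih, zero_add] at h1
        rw [h1]
        exact (setIntegral_pi_eq_zero hsymm hi h0 hv fun _ => K).2
      · intro f hd hf ih
        rw [integral_iUnion hf hd hvK.integrableOn]
        simp [ih]
    have := hvK.ae_eq_zero_of_forall_setIntegral_eq_zero fun s hs _ => hall s hs
    exact (ae_restrict_iff' hKn).1 this
  filter_upwards [ae_all_iff.2 key] with x hx
  obtain ⟨R, hR⟩ := exists_nat_ge ‖x‖
  refine hx R fun i _ => ?_
  simpa using (norm_le_pi_norm x i).trans hR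

lemma coherent_cfg_ae (hd : 0 < d) {f g : Space d → ℂ} (hfg : f =ᵐ[volume] g) (n : ℕ) :
    ∀ᵐ x, coherent f (cfg d n x) = ∏ i, g (x i) := by
  have : ∀ᵐ x : Fin n → Space d, ∀ i, f (x i) = g (x i) :=
    ae_all_iff.2 fun i => ae_pi_of_ae hfg i
  filter_upwards [this, ae_injective hd n] with x hx hinj
  rw [coherent_cfg _ hinj]
  exact Finset.prod_congr rfl fun i _ => hx i

lemma measurable_L1 (θ : L1 d) : Measurable θ := (Lp.stronglyMeasurable θ).measurable

namespace IsCorrelationFunction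

variable {B : L1 d → ℂ} {k : FinConfig d → ℂ}

lemma integrable_prod_mul (hk : IsCorrelationFunction B k) (hd : 0 < d) (θ : L1 d) (n : ℕ) :
    Integrable fun x : Fin n → Space d => (∏ i, θ (x i)) * k (cfg d n x) := by
  refine (integrable_comp_cfg hd ((measurable_coherent (measurable_L1 θ)).mul hk.1)
    (hk.2 θ).1 n).congr ?_
  filter_upwards [coherent_cfg_ae hd (EventuallyEq.refl _ (θ : Space d → ℂ)) n] with x hx
  rw [Pi.mul_apply, hx]

lemma hasSum_of_ae_eq (hk : IsCorrelationFunction B k) (hd : 0 < d) {θ : L1 d}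
    {f : Space d → ℂ} (hf : θ =ᵐ[volume] f) :
    HasSum (fun n : ℕ => (n.factorial : ℂ)⁻¹ *
      ∫ x : Fin n → Space d, (∏ i, f (x i)) * k (cfg d n x)) (B θ) := by
  rw [(hk.2 θ).2]
  refine (hasSum_integral_lebesguePoisson hd
    ((measurable_coherent (measurable_L1 θ)).mul hk.1) (hk.2 θ).1).congr_fun fun n => ?_
  congr 1
  refine integral_congr_ae ?_
  filter_upwards [coherent_cfg_ae hd hf n] with x hx
  rw [Pi.mul_apply, hx]

lemma hasSum_smul (hk : IsCorrelationFunction B k) (hd : 0 < d) (θ : L1 d) (w : ℂ) :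
    HasSum (fun n : ℕ => w ^ n * ((n.factorial : ℂ)⁻¹ *
      ∫ x : Fin n → Space d, (∏ i, θ (x i)) * k (cfg d n x))) (B (w • θ)) := by
  refine (hk.hasSum_of_ae_eq hd (Lp.coeFn_smul w θ)).congr_fun fun n => ?_
  rw [mul_left_comm, ← integral_const_mul]
  congr 1
  refine integral_congr_ae (ae_of_all _ fun x => ?_)
  simp [Finset.prod_mul_distrib, mul_assoc]

theorem ae_eq (hd : 0 < d) {k' : FinConfig d → ℂ} (hk : IsCorrelationFunction B k)
    (hk' : IsCorrelationFunction B k') : k =ᵐ[lebesguePoisson d] k' := by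
  refine ae_lebesguePoisson_of_ae hd (measurableSet_eq_fun hk.1 hk'.1) fun n => ?_
  have hsub : ∀ θ : L1 d, ∀ n, (fun x : Fin n → Space d =>
      (∏ i, θ (x i)) * (k (cfg d n x) - k' (cfg d n x))) =
      fun x => (∏ i, θ (x i)) * k (cfg d n x) - (∏ i, θ (x i)) * k' (cfg d n x) :=
    fun θ n => funext fun x => mul_sub _ _ _
  have := ae_eq_zero_of_symmetric (v := fun x => k (cfg d n x) - k' (cfg d n x))
    (fun σ x => by rw [cfg_comp_perm])
    (fun θ => by
      rw [hsub]
      exact (hk.integrable_prod_mul hd θ n).sub (hk'.integrable_prod_mul hd θ n))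
    (fun θ => by
      rw [hsub, integral_sub (hk.integrable_prod_mul hd θ n) (hk'.integrable_prod_mul hd θ n)]
      have h0 := eq_zero_of_hasSum_pow (fun w => by
        have := (hk.hasSum_smul hd θ w).sub (hk'.hasSum_smul hd θ w)
        simp_rw [← mul_sub] at this
        rwa [sub_self] at this) n
      exact (mul_eq_zero.1 h0).resolve_left
        (inv_ne_zero (by exact_mod_cast n.factorial_ne_zero)))
    ((measurable_comp_cfg hk.1 n).sub (measurable_comp_cfg hk'.1 n))
  filter_upwards [this] with x hx
  exact sub_eq_zero.1 hx

end IsCorrelationFunction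

end Uniqueness

/-! ### The renormalized operator on coherent states -/

section HatRen

lemma sum_powerset_neg_one_pow_mul_prod {ι : Type*} [DecidableEq ι] (s : Finset ι) (a : ι → ℂ) :
    ∑ t ∈ s.powerset, (-1) ^ (s \ t).card * ∏ i ∈ t, a i = ∏ i ∈ s, (a i - 1) := by
  simp_rw [sub_eq_add_neg]
  rw [Finset.prod_add]
  exact Finset.sum_congr rfl fun t _ => by rw [Finset.prod_const, mul_comm]

lemma sum_powerset_neg_one_pow_mul_sum {ι : Type*} [DecidableEq ι] (s : Finset ι) (b : ι → ℂ) :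
    ∑ t ∈ s.powerset, (-1) ^ (s \ t).card * ∑ i ∈ t, b i * ∏ j ∈ t.erase i, (1 + b j) =
      s.card * ∏ i ∈ s, b i := by
  have h1 : HasDerivAt (fun w : ℂ => ∑ t ∈ s.powerset, (-1) ^ (s \ t).card *
      ∏ i ∈ t, (1 + w * b i)) (∑ t ∈ s.powerset, (-1) ^ (s \ t).card *
        ∑ i ∈ t, b i * ∏ j ∈ t.erase i, (1 + b j)) 1 := by
    refine HasDerivAt.fun_sum fun t _ => HasDerivAt.const_mul _ ?_
    have h2 := HasDerivAt.fun_finsetProd (u := t) (f := fun i (w : ℂ) => 1 + w * b i)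
      (f' := b) (x := 1) fun i _ => by
        simpa using ((hasDerivAt_id (1 : ℂ)).mul_const (b i)).const_add 1
    simp only [one_mul, smul_eq_mul] at h2
    simp only [mul_comm (b _)]
    exact h2
  have h3 : (fun w : ℂ => ∑ t ∈ s.powerset, (-1) ^ (s \ t).card * ∏ i ∈ t, (1 + w * b i)) =
      fun w => w ^ s.card * ∏ i ∈ s, b i := by
    funext w
    rw [sum_powerset_neg_one_pow_mul_prod]
    simp [Finset.prod_mul_distrib]
  rw [h3] at h1
  have h4 : HasDerivAt (fun w : ℂ => w ^ s.card * ∏ i ∈ s, b i)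
      (s.card * 1 ^ (s.card - 1) * ∏ i ∈ s, b i) 1 := (hasDerivAt_pow s.card 1).mul_const _
  rw [h1.unique h4]
  simp

lemma expNeg_zero : expNeg 0 = 1 := by simp [expNeg]

lemma expNeg_add (a b : ℝ≥0∞) : expNeg (a + b) = expNeg a * expNeg b := by
  by_cases ha : a = ⊤
  · simp [expNeg, ha]
  by_cases hb : b = ⊤
  · simp [expNeg, hb]
  simp only [expNeg, ha, hb, ENNReal.add_eq_top, or_self, if_false]
  rw [ENNReal.toReal_add ha hb, neg_add, Real.exp_add]

lemma expNeg_sum {ι : Type*} (s : Finset ι) (a : ι → ℝ≥0∞) :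
    expNeg (∑ i ∈ s, a i) = ∏ i ∈ s, expNeg (a i) := by
  classical
  induction s using Finset.induction_on with
  | empty => simp [expNeg_zero]
  | insert i s hi ih => rw [Finset.sum_insert hi, Finset.prod_insert hi, expNeg_add, ih]

variable {d : ℕ}

lemma kTransform_ofFin (G : FinConfig d → ℂ) (ξ : Finset (Space d)) :
    kTransform G (Config.ofFin ⟨ξ⟩) = ∑ s ∈ ξ.powerset, G ⟨s⟩ := by
  let e : {s // s ∈ ξ.powerset} ≃
      {η : FinConfig d // (η.points : Set (Space d)) ⊆ (Config.ofFin ⟨ξ⟩).carrier} :=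
    { toFun := fun s => ⟨⟨s.1⟩, Finset.coe_subset.2 (Finset.mem_powerset.1 s.2)⟩
      invFun := fun η => ⟨η.1.points, Finset.mem_powerset.2 (Finset.coe_subset.1 η.2)⟩
      left_inv := fun _ => rfl
      right_inv := fun _ => rfl }
  rw [kTransform, ← e.tsum_eq]
  exact Finset.tsum_subtype ξ.powerset fun s => G ⟨s⟩

lemma kTransform_coherent (ε : ℂ) (f : Space d → ℂ) (ξ : Finset (Space d)) :
    kTransform (fun η => ε ^ η.points.card * coherent f η) (Config.ofFin ⟨ξ⟩) =
      ∏ y ∈ ξ, (1 + ε * f y) := by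
  classical
  rw [kTransform_ofFin, Finset.prod_one_add]
  refine Finset.sum_congr rfl fun s _ => ?_
  simp [coherent, Finset.prod_mul_distrib]

open Classical in
lemma remove_ofFin (ξ : Finset (Space d)) (x : Space d) :
    (Config.ofFin ⟨ξ⟩).remove x = Config.ofFin ⟨ξ.erase x⟩ := by
  ext y; simp [Config.remove, Config.ofFin, and_comm]

open Classical in
lemma add_ofFin (ξ : Finset (Space d)) (x : Space d) :
    (Config.ofFin ⟨ξ⟩).add x = Config.ofFin ⟨insert x ξ⟩ := by
  ext y; simp [Config.add, Config.ofFin]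

lemma energy_ofFin (ψ : Space d → ℝ≥0∞) (x : Space d) (ξ : Finset (Space d)) :
    energy ψ x (Config.ofFin ⟨ξ⟩) = ∑ y ∈ ξ, ψ (x - y) :=
  Finset.tsum_subtype ξ fun y => ψ (x - y)

/-- The factor `e^{-εφ(x - y)}`. -/
def boltzmann (φ : PairPotential d) (ε : ℝ) (x y : Space d) : ℂ :=
  (expNeg (ENNReal.ofReal ε * φ.toFun (x - y)) : ℂ)

lemma norm_boltzmann_le_one (φ : PairPotential d) (ε : ℝ) (x y : Space d) :
    ‖boltzmann φ ε x y‖ ≤ 1 := by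
  rw [boltzmann, Complex.norm_real, Real.norm_of_nonneg (expNeg_nonneg _)]
  exact expNeg_le_one _

lemma measurable_boltzmann (φ : PairPotential d) (ε : ℝ) :
    Measurable fun p : Space d × Space d => boltzmann φ ε p.1 p.2 :=
  Complex.measurable_ofReal.comp (measurable_expNeg.comp
    ((φ.measurable.comp (measurable_fst.sub measurable_snd)).const_mul _))

lemma measurable_boltzmann_left (φ : PairPotential d) (ε : ℝ) (y : Space d) :
    Measurable fun x => boltzmann φ ε x y :=
  (measurable_boltzmann φ ε).comp (measurable_id.prodMk measurable_const)

lemma glauberScaled_ofFin (hd : 0 < d) (φ : PairPotential d) (z ε : ℝ) (f : Space d → ℂ)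
    (ξ : Finset (Space d)) :
    glauberScaled φ z ε (kTransform fun η => (ε : ℂ) ^ η.points.card * coherent f η)
        (Config.ofFin ⟨ξ⟩) =
      -(∑ x ∈ ξ, ε * f x * ∏ y ∈ ξ.erase x, (1 + ε * f y)) +
        ((z / ε : ℝ) : ℂ) * ∫ x, (∏ y ∈ ξ, boltzmann φ ε x y * (1 + ε * f y)) * (ε * f x) := by
  classical
  have : Nonempty (Fin d) := ⟨⟨0, hd⟩⟩
  unfold glauberScaled glauber
  congr 1
  · have h1 := Finset.tsum_subtype ξ fun x => ∏ y ∈ ξ.erase x, (1 + (ε : ℂ) * f y) -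
      ∏ y ∈ ξ, (1 + (ε : ℂ) * f y)
    simp_rw [remove_ofFin, kTransform_coherent]
    refine Eq.trans h1 ?_
    rw [← Finset.sum_neg_distrib]
    refine Finset.sum_congr rfl fun x hx => ?_
    rw [← Finset.mul_prod_erase ξ _ hx]
    ring
  · congr 1
    refine integral_congr_ae ?_
    have hne : ∀ᵐ x : Space d, x ∉ (ξ : Set (Space d)) :=
      measure_eq_zero_iff_ae_notMem.1 (ξ.finite_toSet.measure_zero volume)
    filter_upwards [hne] with x hx
    have hx : x ∉ ξ := by simpa using hx
    rw [add_ofFin, kTransform_coherent, kTransform_coherent, energy_ofFin, expNeg_sum,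
      Finset.prod_insert hx, Finset.prod_mul_distrib, Complex.ofReal_prod]
    simp only [boltzmann]
    ring

lemma shiftFun_eq (φ : PairPotential d) {ε : ℝ} (hε : 0 < ε) (θ : L1 d) (x y : Space d) :
    boltzmann φ ε x y * (1 + ε * θ y) - 1 = ε * shiftFun φ ε θ x y := by
  have : (ε : ℂ) ≠ 0 := by exact_mod_cast hε.ne'
  simp only [shiftFun, boltzmann]
  field_simp
  ring

/-- The operator `L̂_{ε,ren}` on a coherent state. -/
theorem hatRen_coherent (hd : 0 < d) (φ : PairPotential d) (z : ℝ) {ε : ℝ} (hε : 0 < ε)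
    (θ : L1 d) (η : FinConfig d) :
    hatRen φ z ε (coherent θ) η = -(η.points.card * coherent θ η) +
      z * ∫ x, θ x * coherent (shiftFun φ ε θ x) η := by
  classical
  have hε' : (ε : ℂ) ≠ 0 := by exact_mod_cast hε.ne'
  have hint : ∀ ξ : Finset (Space d), Integrable fun x : Space d =>
      (∏ y ∈ ξ, boltzmann φ ε x y * (1 + ε * θ y)) * (ε * θ x) := fun ξ => by
    refine ((L1.integrable_coeFn θ).const_mul (ε : ℂ)).bdd_mul
      (c := ∏ y ∈ ξ, ‖(1 + ε * θ y : ℂ)‖) ?_ (ae_of_all _ fun x => ?_)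
    · exact (Finset.measurable_fun_prod _ fun y _ =>
        (measurable_boltzmann_left φ ε y).mul_const _).aestronglyMeasurable
    · rw [norm_prod]
      refine Finset.prod_le_prod (fun _ _ => norm_nonneg _) fun y _ => ?_
      rw [norm_mul]
      exact mul_le_of_le_one_left (norm_nonneg _) (norm_boltzmann_le_one φ ε x y)
  simp only [hatRen, hatScaled, kInverse, glauberScaled_ofFin hd]
  rw [Finset.sum_congr rfl fun ξ _ => mul_add _ _ _, Finset.sum_add_distrib, mul_add]
  congr 1
  · have h := sum_powerset_neg_one_pow_mul_sum η.points fun x => (ε : ℂ) * θ x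
    simp_rw [mul_neg]
    rw [Finset.sum_neg_distrib, h, Finset.prod_mul_distrib, Finset.prod_const, coherent]
    have : (ε : ℂ)⁻¹ ^ η.points.card * (ε : ℂ) ^ η.points.card = 1 := by
      rw [← mul_pow, inv_mul_cancel₀ hε', one_pow]
    linear_combination (-(η.points.card : ℂ) * ∏ x ∈ η.points, θ x) * this
  · simp_rw [mul_left_comm _ ((z / ε : ℝ) : ℂ), ← integral_const_mul ((-1 : ℂ) ^ _)]
    rw [← Finset.mul_sum, ← integral_finsetSum _ fun ξ _ => (hint ξ).const_mul _,
      ← integral_const_mul, ← integral_const_mul, ← integral_const_mul]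
    refine integral_congr_ae (ae_of_all _ fun x => ?_)
    have h := sum_powerset_neg_one_pow_mul_prod η.points fun y =>
      boltzmann φ ε x y * (1 + ε * θ y)
    simp only [← mul_assoc, ← Finset.sum_mul]
    rw [h]
    simp_rw [shiftFun_eq φ hε]
    rw [Finset.prod_mul_distrib, Finset.prod_const, coherent]
    have : (ε : ℂ)⁻¹ ^ η.points.card * (ε : ℂ) ^ η.points.card = 1 := by
      rw [← mul_pow, inv_mul_cancel₀ hε', one_pow]
    push_cast
    field_simp
    linear_combination (z * θ x * ∏ y ∈ η.points, shiftFun φ ε θ x y) * this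

end HatRen

/-! ### Existence of the correlation function -/

section Existence

variable {d : ℕ}

lemma IsEntire.bddEntire {B : L1 d → ℂ} (hB : IsEntire B) (hB' : IsOfBoundedType B) :
    BddEntire B where
  line := hB.2
  bdd R := by
    obtain ⟨C, hC⟩ := hB' 0 (max R 1) (by positivity)
    exact ⟨C, fun θ hθ => by simpa using hC θ (hθ.trans (le_max_left _ _))⟩

/-- The weight `K` has the growth of the sup norms of the Taylor kernels of an entire function
of bounded type. -/
def IsSummableWeight (K : ℕ → ℝ) : Prop :=
  ∀ R : ℝ, 0 ≤ R → Summable fun n : ℕ => (n + 1 : ℝ) * ((n.factorial : ℝ)⁻¹ * (K n * R ^ n))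

lemma isSummableWeight_of_le {K : ℕ → ℝ} (hK0 : ∀ n, 0 ≤ K n)
    (hK : ∀ r : ℝ, 0 < r → ∃ M : ℝ, ∀ n : ℕ, K n ≤ M * (n / r) ^ n) : IsSummableWeight K := by
  intro R hR
  obtain ⟨M, hM⟩ := hK (4 * Real.exp 1 * (R + 1)) (by positivity)
  have hM0 : 0 ≤ M := by simpa using (hK0 0).trans (hM 0)
  refine Summable.of_nonneg_of_le (fun n => by have := hK0 n; positivity) (fun n => ?_)
    (summable_geometric_two.mul_left M)
  have h1 : (n + 1 : ℝ) ≤ 2 ^ n := by exact_mod_cast Nat.succ_le_of_lt n.lt_two_pow_self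
  have h2 : (n : ℝ) ^ n * (n.factorial : ℝ)⁻¹ ≤ Real.exp 1 ^ n := by
    rw [← Real.exp_nat_mul, mul_one, ← div_eq_mul_inv]
    exact Real.pow_div_factorial_le_exp n (Nat.cast_nonneg n) n
  have h3 : R ^ n ≤ (R + 1) ^ n := by gcongr; linarith
  have hR1 : 0 < R + 1 := by linarith
  calc (n + 1 : ℝ) * ((n.factorial : ℝ)⁻¹ * (K n * R ^ n))
      ≤ 2 ^ n * ((n.factorial : ℝ)⁻¹ * ((M * (n / (4 * Real.exp 1 * (R + 1))) ^ n) *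
          (R + 1) ^ n)) := by
        have := hK0 n
        have := hM n
        gcongr
    _ = M * ((n : ℝ) ^ n * (n.factorial : ℝ)⁻¹) * (2 ^ n * (R + 1) ^ n /
          (4 * Real.exp 1 * (R + 1)) ^ n) := by rw [div_pow]; ring
    _ ≤ M * Real.exp 1 ^ n * (2 ^ n * (R + 1) ^ n / (4 * Real.exp 1 * (R + 1)) ^ n) := by
        gcongr
    _ = M * (1 / 2) ^ n := by
        rw [mul_assoc, ← mul_pow, ← div_pow, ← mul_pow]
        congr 2
        field_simp
        norm_num

lemma IsSummableWeight.summable {K : ℕ → ℝ} (hK : IsSummableWeight K) (hK0 : ∀ n, 0 ≤ K n)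
    {R : ℝ} (hR : 0 ≤ R) : Summable fun n : ℕ => (n.factorial : ℝ)⁻¹ * (K n * R ^ n) := by
  refine Summable.of_nonneg_of_le (fun n => by have := hK0 n; positivity) (fun n => ?_) (hK R hR)
  have := hK0 n
  refine le_mul_of_one_le_left (by positivity) ?_
  linarith [(Nat.cast_nonneg n : (0 : ℝ) ≤ n)]

lemma exists_symmetric_kernel {B : L1 d → ℂ} (hf : BddEntire B) :
    ∃ (κ : ∀ n : ℕ, (Fin n → Space d) → ℂ) (K : ℕ → ℝ), (∀ n, Measurable (κ n)) ∧
      (∀ n (σ : Equiv.Perm (Fin n)) x, κ n (x ∘ σ) = κ n x) ∧ (∀ n, 0 ≤ K n) ∧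
      (∀ n x, ‖κ n x‖ ≤ K n) ∧ IsSummableWeight K ∧
      ∀ n (θ : L1 d), iteratedDeriv n (fun w : ℂ => B (w • θ)) 0 =
        ∫ x : Fin n → Space d, (∏ i, θ (x i)) * κ n x := by
  obtain ⟨M1, hM1⟩ := hf.bdd 1
  let Ac : ∀ n, ContinuousMultilinearMap ℂ (fun _ : Fin n => L1 d) ℂ := fun n =>
    (hf.differential n).mkContinuous _ (hf.norm_differential_le one_pos hM1 n)
  have hAc : ∀ n h, ‖hf.differential n h‖ ≤ ‖Ac n‖ * ∏ i, ‖h i‖ := fun n h => (Ac n).le_opNorm h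
  choose k hkm hkb hk using fun n => exists_kernel (norm_nonneg (Ac n)) (hAc n)
  refine ⟨fun n x => (n.factorial : ℂ)⁻¹ * ∑ σ : Equiv.Perm (Fin n), k n (x ∘ σ),
    fun n => 2 * ‖Ac n‖, fun n => ?_, fun n τ x => ?_, fun n => by positivity, fun n x => ?_, ?_,
    fun n θ => ?_⟩
  · refine (Finset.measurable_fun_sum _ fun σ _ => (hkm n).comp ?_).const_mul _
    exact measurable_pi_lambda _ fun i => measurable_pi_apply (σ i)
  · simp only [Function.comp_assoc]
    congr 1
    exact (Equiv.sum_comp (Equiv.mulLeft τ) fun σ : Equiv.Perm (Fin n) => k n (x ∘ σ))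
  · rw [norm_mul, norm_inv, Complex.norm_natCast]
    have hn : (0 : ℝ) < n.factorial := by exact_mod_cast n.factorial_pos
    rw [inv_mul_le_iff₀ hn]
    calc ‖∑ σ : Equiv.Perm (Fin n), k n (x ∘ σ)‖
        ≤ ∑ _σ : Equiv.Perm (Fin n), 2 * ‖Ac n‖ := norm_sum_le_of_le _ fun σ _ => hkb n _
      _ = _ := by simp [Finset.card_univ, Fintype.card_perm]
  · refine isSummableWeight_of_le (fun n => by positivity) fun r hr => ?_
    obtain ⟨M, hM⟩ := hf.bdd r
    have hM0 : 0 ≤ M := (norm_nonneg _).trans (hM 0 (by simpa using hr.le))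
    refine ⟨2 * M, fun n => ?_⟩
    rw [mul_assoc]
    have := (Ac n).opNorm_le_bound (by positivity) (hf.norm_differential_le hr hM n)
    gcongr
  · rw [hf.iteratedDeriv_zero_eq_differential, hk]
    have hint : ∀ σ : Equiv.Perm (Fin n), Integrable fun x : Fin n → Space d =>
        (∏ i, θ (x i)) * k n (x ∘ σ) := fun σ =>
      (integrable_tensor (μ := volume) fun _ : Fin n => θ).mul_bdd (c := 2 * ‖Ac n‖)
        ((hkm n).comp (measurable_pi_lambda _ fun i =>
          measurable_pi_apply (σ i))).aestronglyMeasurable (ae_of_all _ fun x => hkb n _)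
    have e : ∀ x : Fin n → Space d, (∏ i, θ (x i)) *
        ((n.factorial : ℂ)⁻¹ * ∑ σ : Equiv.Perm (Fin n), k n (x ∘ σ)) =
        (n.factorial : ℂ)⁻¹ * ∑ σ : Equiv.Perm (Fin n), (∏ i, θ (x i)) * k n (x ∘ σ) := fun x => by
      rw [Finset.mul_sum, Finset.mul_sum, Finset.mul_sum]
      exact Finset.sum_congr rfl fun σ _ => by ring
    have hσ : ∀ σ : Equiv.Perm (Fin n), ∫ x : Fin n → Space d, (∏ i, θ (x i)) * k n (x ∘ σ) =
        ∫ x : Fin n → Space d, k n x * ∏ i, θ (x i) := fun σ => by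
      rw [← integral_comp_perm σ fun x => k n x * ∏ i, θ (x i)]
      refine integral_congr_ae (ae_of_all _ fun x => ?_)
      simp only [Function.comp]
      rw [Equiv.prod_comp σ fun i => θ (x i), mul_comm]
    simp_rw [e]
    rw [integral_const_mul, integral_finsetSum _ fun σ _ => hint σ, Finset.sum_congr rfl
      fun σ _ => hσ σ, Finset.sum_const, Finset.card_univ, Fintype.card_perm, Fintype.card_fin,
      nsmul_eq_mul, inv_mul_cancel_left₀ (by exact_mod_cast n.factorial_ne_zero)]
    rfl

/-- The `n`-point part of `k` is bounded by `K n`. -/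
def HasWeight (k : FinConfig d → ℂ) (K : ℕ → ℝ) : Prop :=
  ∀ n, ∀ᵐ x, ‖k (cfg d n x)‖ ≤ K n

lemma integrable_prod_mul_of_hasWeight {k : FinConfig d → ℂ} (hkm : Measurable k) {K : ℕ → ℝ}
    (hk : HasWeight k K) {f : Space d → ℂ} (hf : Integrable f) (n : ℕ) :
    Integrable fun x : Fin n → Space d => (∏ i, f (x i)) * k (cfg d n x) :=
  (Integrable.fintype_prod fun _ => hf).mul_bdd
    (measurable_comp_cfg hkm n).aestronglyMeasurable (hk n)

lemma integral_norm_prod_mul_le {k : FinConfig d → ℂ} (hkm : Measurable k) {K : ℕ → ℝ}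
    (hk : HasWeight k K) {f : Space d → ℂ} (hf : Integrable f) (n : ℕ) :
    ∫ x : Fin n → Space d, ‖(∏ i, f (x i)) * k (cfg d n x)‖ ≤ K n * (∫ y, ‖f y‖) ^ n := by
  have h1 : Integrable fun x : Fin n → Space d => K n * ∏ i, ‖f (x i)‖ :=
    (Integrable.fintype_prod fun _ => hf.norm).const_mul _
  have h2 : ∫ x : Fin n → Space d, K n * ∏ i, ‖f (x i)‖ = K n * (∫ y, ‖f y‖) ^ n := by
    rw [integral_const_mul, volume_pi,
      integral_fintype_prod_eq_prod (μ := fun _ : Fin n => volume) fun _ y => ‖f y‖]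
    simp
  rw [← h2]
  refine integral_mono_ae (integrable_prod_mul_of_hasWeight hkm hk hf n).norm h1 ?_
  filter_upwards [hk n] with x hx
  rw [norm_mul, norm_prod, mul_comm]
  gcongr

theorem exists_correlationFunction (hd : 0 < d) {B : L1 d → ℂ} (hf : BddEntire B) :
    ∃ (k : FinConfig d → ℂ) (K : ℕ → ℝ), IsCorrelationFunction B k ∧ (∀ n, 0 ≤ K n) ∧
      IsSummableWeight K ∧ HasWeight k K := by
  obtain ⟨κ, K, hκm, hκs, hK0, hκK, hK, hκ⟩ := exists_symmetric_kernel hf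
  let k : FinConfig d → ℂ := ofSymmetric κ
  have hkm : Measurable k := measurable_ofSymmetric hκs hκm
  have hkκ : ∀ n, ∀ᵐ x, k (cfg d n x) = κ n x := fun n => by
    filter_upwards [ae_injective hd n] with x hx
    rw [cfg_of_injective hx]
    exact ofSymmetric_symm hκs ⟨x, hx⟩
  have hkK : HasWeight k K := fun n => by
    filter_upwards [hkκ n] with x hx
    rw [hx]; exact hκK n x
  refine ⟨k, K, ⟨hkm, fun θ => ?_⟩, hK0, hK, hkK⟩
  have hm := (measurable_coherent (measurable_L1 θ)).mul hkm
  have hae : ∀ n, (fun x => coherent θ (cfg d n x) * k (cfg d n x)) =ᵐ[volume]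
      fun x => (∏ i, θ (x i)) * k (cfg d n x) := fun n => by
    filter_upwards [coherent_cfg_ae hd (EventuallyEq.refl _ (θ : Space d → ℂ)) n] with x hx
    rw [hx]
  have hi : Integrable (fun η => coherent θ η * k η) (lebesguePoisson d) := by
    refine integrable_lebesguePoisson hd hm (hK.summable hK0 (norm_nonneg θ)) (fun n => ?_)
      fun n => ?_
    · exact (integrable_prod_mul_of_hasWeight hkm hkK (L1.integrable_coeFn θ) n).congr
        (hae n).symm
    · gcongr
      rw [norm_L1_eq]
      refine (integral_congr_ae ?_).trans_le
        (integral_norm_prod_mul_le hkm hkK (L1.integrable_coeFn θ) n)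
      filter_upwards [hae n] with x hx
      simp only [hx]
  refine ⟨hi, ?_⟩
  have h1 := hasSum_integral_lebesguePoisson hd hm hi
  have hent : Differentiable ℂ fun w : ℂ => B (w • θ) := by simpa using hf.line 0 θ
  have h2 := Complex.hasSum_taylorSeries_of_entire hent 0 1
  rw [one_smul] at h2
  refine h2.unique (h1.congr_fun fun n => ?_)
  rw [sub_zero, one_pow, one_smul, hκ, smul_eq_mul]
  congr 1
  refine integral_congr_ae ?_
  filter_upwards [hae n, hkκ n] with x hx hx'
  rw [← hx', Pi.mul_apply]
  exact hx.symm

end Existence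

/-! ### The generator on generating functionals -/

section Generator

variable {d : ℕ}

lemma measurable_shiftFun (φ : PairPotential d) (ε : ℝ) (θ : L1 d) :
    Measurable fun p : Space d × Space d => shiftFun φ ε θ p.1 p.2 :=
  (((measurable_L1 θ).comp measurable_snd).mul (measurable_boltzmann φ ε)).add
    (((measurable_boltzmann φ ε).sub_const 1).div_const _)

lemma measurable_prod_shiftFun (φ : PairPotential d) (ε : ℝ) (θ : L1 d) (n : ℕ) :
    Measurable fun p : Space d × (Fin n → Space d) => ∏ i, shiftFun φ ε θ p.1 (p.2 i) :=
  Finset.measurable_fun_prod _ fun i _ => (measurable_shiftFun φ ε θ).comp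
    (measurable_fst.prodMk ((measurable_pi_apply i).comp measurable_snd))

lemma integrable_shiftFun (φ : PairPotential d) (ε : ℝ) (θ : L1 d) (x : Space d) :
    Integrable (shiftFun φ ε θ x) :=
  memLp_one_iff_integrable.1 (memLp_shiftFun φ ε θ x)

lemma integral_norm_shiftFun_le (φ : PairPotential d) {ε : ℝ} (hε : 0 < ε) (θ : L1 d)
    (x : Space d) : ∫ y, ‖shiftFun φ ε θ x y‖ ≤ ‖θ‖ + ∫ y, (φ.toFun y).toReal := by
  have hφm : Measurable fun y : Space d => φ.toFun (x - y) :=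
    φ.measurable.comp (measurable_const.sub measurable_id)
  have hlint : ∫⁻ y, φ.toFun (x - y) ≠ ⊤ := by
    rw [lintegral_sub_left_eq_self (fun y => φ.toFun y) x]
    exact φ.integrable
  have hint : Integrable fun y : Space d => (φ.toFun (x - y)).toReal :=
    integrable_toReal_of_lintegral_ne_top hφm.aemeasurable hlint
  rw [norm_L1_eq, ← integral_sub_left_eq_self (fun y => (φ.toFun y).toReal) volume x,
    ← integral_add (L1.integrable_coeFn θ).norm hint]
  refine integral_mono_ae (integrable_shiftFun φ ε θ x).norm
    ((L1.integrable_coeFn θ).norm.add hint) ?_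
  filter_upwards [ae_lt_top hφm hlint] with y hy
  refine (norm_add_le _ _).trans (add_le_add ?_ ?_)
  · rw [norm_mul]
    exact mul_le_of_le_one_right (norm_nonneg _) (norm_boltzmann_le_one φ ε x y)
  · have hne : ENNReal.ofReal ε * φ.toFun (x - y) ≠ ⊤ :=
      ENNReal.mul_ne_top ENNReal.ofReal_ne_top hy.ne
    have h1 := one_sub_expNeg_le _ hne
    rw [ENNReal.toReal_mul, ENNReal.toReal_ofReal hε.le] at h1
    rw [norm_div, Complex.norm_real, Real.norm_of_nonneg hε.le, div_le_iff₀ hε,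
      ← Complex.ofReal_one, ← Complex.ofReal_sub, Complex.norm_real, Real.norm_eq_abs,
      abs_sub_comm, abs_of_nonneg (sub_nonneg.2 (expNeg_le_one _))]
    linarith

lemma measurable_hatRen_coherent (hd : 0 < d) (φ : PairPotential d) (z : ℝ) {ε : ℝ} (hε : 0 < ε)
    (θ : L1 d) : Measurable (hatRen φ z ε (coherent θ)) := by
  rw [measurable_finConfig_iff]
  intro n
  have e : (fun x => hatRen φ z ε (coherent θ) (symm d n x)) = fun x =>
      -((n : ℂ) * ∏ i, θ (x.1 i)) + z * ∫ y, θ y * ∏ i, shiftFun φ ε θ y (x.1 i) := by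
    funext x
    rw [hatRen_coherent hd φ z hε, coherent_symm]
    simp_rw [coherent_symm]
    simp [symm]
  rw [e]
  have h1 : StronglyMeasurable fun x : Fin n → Space d =>
      ∫ y, θ y * ∏ i, shiftFun φ ε θ y (x i) := by
    refine StronglyMeasurable.integral_prod_right
      (f := fun (x : Fin n → Space d) (y : Space d) => θ y * ∏ i, shiftFun φ ε θ y (x i)) ?_
    exact (((measurable_L1 θ).comp measurable_snd).mul
      ((measurable_prod_shiftFun φ ε θ n).comp measurable_swap)).stronglyMeasurable
  exact ((Finset.measurable_fun_prod _ fun i _ => (measurable_L1 θ).comp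
    ((measurable_pi_apply i).comp measurable_subtype_coe)).const_mul _).neg.add
    ((h1.measurable.comp measurable_subtype_coe).const_mul _)

lemma hatRen_coherent_cfg (hd : 0 < d) (φ : PairPotential d) (z : ℝ) {ε : ℝ} (hε : 0 < ε)
    (θ : L1 d) (n : ℕ) : ∀ᵐ x, hatRen φ z ε (coherent θ) (cfg d n x) =
      -((n : ℂ) * ∏ i, θ (x i)) + z * ∫ y, θ y * ∏ i, shiftFun φ ε θ y (x i) := by
  filter_upwards [ae_injective hd n] with x hx
  rw [hatRen_coherent hd φ z hε, coherent_cfg _ hx, card_cfg hx]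
  simp_rw [coherent_cfg _ hx]

section Fubini

variable {k : FinConfig d → ℂ} (hkm : Measurable k) {K : ℕ → ℝ} (hk : HasWeight k K)
  (hK0 : ∀ n, 0 ≤ K n) (φ : PairPotential d) {ε : ℝ} (hε : 0 < ε) (θ : L1 d) (n : ℕ)

/-- The `L¹`-bound on the functions `shiftFun φ ε θ x`. -/
def shiftBound (φ : PairPotential d) (θ : L1 d) : ℝ := ‖θ‖ + ∫ y, (φ.toFun y).toReal

lemma shiftBound_nonneg : 0 ≤ shiftBound φ θ :=
  add_nonneg (norm_nonneg _) (integral_nonneg fun _ => ENNReal.toReal_nonneg)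

/-- The integrand of the `n`-point part of the birth term. -/
def birth (φ : PairPotential d) (ε : ℝ) (θ : L1 d) (k : FinConfig d → ℂ) (n : ℕ) (y : Space d)
    (x : Fin n → Space d) : ℂ :=
  θ y * ((∏ i, shiftFun φ ε θ y (x i)) * k (cfg d n x))

include hkm in
lemma measurable_birth :
    Measurable fun p : Space d × (Fin n → Space d) => birth φ ε θ k n p.1 p.2 :=
  ((measurable_L1 θ).comp measurable_fst).mul ((measurable_prod_shiftFun φ ε θ n).mul
    ((measurable_comp_cfg hkm n).comp measurable_snd))

include hkm hk hK0 hε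

lemma integral_norm_prod_shiftFun_le (y : Space d) :
    ∫ x : Fin n → Space d, ‖(∏ i, shiftFun φ ε θ y (x i)) * k (cfg d n x)‖ ≤
      K n * shiftBound φ θ ^ n := by
  refine (integral_norm_prod_mul_le hkm hk (integrable_shiftFun φ ε θ y) n).trans ?_
  have := hK0 n
  have := integral_norm_shiftFun_le φ hε θ y
  gcongr
  exact this

lemma integral_norm_birth_le (y : Space d) :
    ∫ x, ‖birth φ ε θ k n y x‖ ≤ ‖θ y‖ * (K n * shiftBound φ θ ^ n) := by
  simp only [birth, norm_mul (θ y)]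
  rw [integral_const_mul]
  gcongr
  exact integral_norm_prod_shiftFun_le hkm hk hK0 φ hε θ n y

lemma integrable_birth : Integrable
    (fun p : Space d × (Fin n → Space d) => birth φ ε θ k n p.1 p.2) (volume.prod volume) := by
  have hm := measurable_birth hkm φ (ε := ε) θ n
  have h1 : ∀ y, Integrable fun x => birth φ ε θ k n y x := fun y =>
    (integrable_prod_mul_of_hasWeight hkm hk (integrable_shiftFun φ ε θ y) n).const_mul (θ y)
  have h2 : Integrable fun y => ∫ x, ‖birth φ ε θ k n y x‖ := by
    refine ((L1.integrable_coeFn θ).norm.mul_const (K n * shiftBound φ θ ^ n)).mono'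
      (hm.norm.stronglyMeasurable.integral_prod_right').aestronglyMeasurable
      (ae_of_all _ fun y => ?_)
    rw [Real.norm_of_nonneg (integral_nonneg fun _ => norm_nonneg _)]
    exact integral_norm_birth_le hkm hk hK0 φ hε θ n y
  exact (integrable_prod_iff hm.aestronglyMeasurable).2 ⟨ae_of_all _ h1, h2⟩

lemma integrable_integral_birth : Integrable fun x => ∫ y, birth φ ε θ k n y x :=
  (integrable_birth hkm hk hK0 φ hε θ n).integral_prod_right

lemma integral_norm_integral_birth_le :
    ∫ x, ‖∫ y, birth φ ε θ k n y x‖ ≤ ‖θ‖ * (K n * shiftBound φ θ ^ n) := by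
  have hi := integrable_birth hkm hk hK0 φ hε θ n
  calc ∫ x, ‖∫ y, birth φ ε θ k n y x‖ ≤ ∫ x, ∫ y, ‖birth φ ε θ k n y x‖ :=
        integral_mono (integrable_integral_birth hkm hk hK0 φ hε θ n).norm
          hi.norm.integral_prod_right fun x => norm_integral_le_integral_norm _
    _ = ∫ y, ∫ x, ‖birth φ ε θ k n y x‖ := (integral_integral_swap hi.norm).symm
    _ ≤ ∫ y, ‖θ y‖ * (K n * shiftBound φ θ ^ n) :=
        integral_mono hi.norm.integral_prod_left ((L1.integrable_coeFn θ).norm.mul_const _)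
          fun y => integral_norm_birth_le hkm hk hK0 φ hε θ n y
    _ = _ := by rw [integral_mul_const, norm_L1_eq]

end Fubini

lemma coeFn_shift (φ : PairPotential d) (ε : ℝ) (θ : L1 d) (x : Space d) :
    shift φ ε θ x =ᵐ[volume] shiftFun φ ε θ x := (memLp_shiftFun φ ε θ x).coeFn_toLp

/-- The expected number of points against a coherent state is a variational derivative. -/
lemma hasSum_number {B : L1 d → ℂ} {k : FinConfig d → ℂ} (hd : 0 < d)
    (hB : IsCorrelationFunction B k) (θ : L1 d) (hf : BddEntire B) {g : Space d → ℂ} (hg : IsVariationalDerivative B θ g) :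
    HasSum (fun n : ℕ => (n.factorial : ℂ)⁻¹ *
        ((n : ℂ) * ∫ x : Fin n → Space d, (∏ i, θ (x i)) * k (cfg d n x)))
      (∫ x, g x * θ x) := by
  let b : ℂ → ℂ := fun w => B (w • θ)
  have hb : Differentiable ℂ b := by simpa [b] using hf.line 0 θ
  have hb' : Differentiable ℂ (deriv b) :=
    ((contDiff_succ_iff_deriv (n := 1)).1 (hb.contDiff (n := 2))).2.2.differentiable (by norm_num)
  have hderiv : deriv b 1 = ∫ x, g x * θ x := by
    have h1 : HasDerivAt b (deriv b 1) (1 + 0) := by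
      rw [add_zero]; exact (hb 1).hasDerivAt
    have h2 := h1.comp_const_add 1 0
    refine h2.unique ((hg.2 θ).congr_of_eventuallyEq (Eventually.of_forall fun w => ?_))
    simp only [b, add_smul, one_smul]
  have hcoef : ∀ n : ℕ, (n.factorial : ℂ)⁻¹ *
      ∫ x : Fin n → Space d, (∏ i, θ (x i)) * k (cfg d n x) =
      (n.factorial : ℂ)⁻¹ * iteratedDeriv n b 0 := fun n => by
    refine sub_eq_zero.1 (eq_zero_of_hasSum_pow (c := fun n => (n.factorial : ℂ)⁻¹ *
      (∫ x : Fin n → Space d, (∏ i, θ (x i)) * k (cfg d n x)) -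
      (n.factorial : ℂ)⁻¹ * iteratedDeriv n b 0) (fun w => ?_) n)
    have h1 := (hB.hasSum_smul hd θ w).sub (Complex.hasSum_taylorSeries_of_entire hb 0 w)
    rw [sub_self] at h1
    refine h1.congr_fun fun n => ?_
    simp only [sub_zero, smul_eq_mul]
    ring
  rw [← hderiv, ← hasSum_nat_add_iff' 1]
  have h1 := Complex.hasSum_taylorSeries_of_entire hb' 0 1
  simp only [Finset.range_one, Finset.sum_singleton, Nat.cast_zero, zero_mul, mul_zero, sub_zero]
  refine h1.congr_fun fun n => ?_
  rw [mul_left_comm, hcoef, sub_zero, one_pow, one_smul, smul_eq_mul, ← iteratedDeriv_succ',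
    Nat.factorial_succ]
  have : (n.factorial : ℂ) ≠ 0 := by exact_mod_cast n.factorial_ne_zero
  have : ((n + 1 : ℕ) : ℂ) ≠ 0 := by exact_mod_cast n.succ_ne_zero
  push_cast at this ⊢
  field_simp

section Main

variable {B : L1 d → ℂ} {k : FinConfig d → ℂ} (hd : 0 < d) (hB : IsCorrelationFunction B k)
  {K : ℕ → ℝ} (hk : HasWeight k K) (hK0 : ∀ n, 0 ≤ K n) (hK : IsSummableWeight K)
  (φ : PairPotential d) (z : ℝ) {ε : ℝ} (hε : 0 < ε) (θ : L1 d)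

include hd hB hk hK0 hK hε

/-- The birth part, summed over the number of points. -/
lemma hasSum_integral_birth : Integrable (fun y => θ y * B (shift φ ε θ y)) ∧
    HasSum (fun n : ℕ => (n.factorial : ℂ)⁻¹ * ∫ x, ∫ y, birth φ ε θ k n y x)
      (∫ y, θ y * B (shift φ ε θ y)) := by
  have hS := hK.summable hK0 (shiftBound_nonneg φ θ)
  let F : ℕ → Space d → ℂ := fun n y => (n.factorial : ℂ)⁻¹ * ∫ x, birth φ ε θ k n y x
  have hFi : ∀ n, Integrable (F n) := fun n =>
    (integrable_birth hB.1 hk hK0 φ hε θ n).integral_prod_left.const_mul _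
  have hFn : ∀ n y, ‖F n y‖ ≤
      ‖θ y‖ * ((n.factorial : ℝ)⁻¹ * (K n * shiftBound φ θ ^ n)) := fun n y => by
    simp only [F, norm_mul, norm_inv, Complex.norm_natCast]
    rw [mul_left_comm]
    gcongr
    exact (norm_integral_le_integral_norm _).trans
      (integral_norm_birth_le hB.1 hk hK0 φ hε θ n y)
  have hFsum : ∀ y, HasSum (fun n => F n y) (θ y * B (shift φ ε θ y)) := fun y => by
    have := (hB.hasSum_of_ae_eq hd (coeFn_shift φ ε θ y)).mul_left (θ y)
    refine this.congr_fun fun n => ?_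
    simp only [F, birth]
    rw [integral_const_mul, mul_left_comm]
  have hθi := L1.integrable_coeFn θ
  constructor
  · refine (hθi.norm.mul_const
      (∑' n : ℕ, (n.factorial : ℝ)⁻¹ * (K n * shiftBound φ θ ^ n))).mono' ?_
      (ae_of_all _ fun y => ?_)
    · refine aestronglyMeasurable_of_tendsto_ae atTop
        (f := fun (N : ℕ) y => ∑ n ∈ Finset.range N, F n y) (fun N => ?_)
        (ae_of_all _ fun y => (hFsum y).tendsto_sum_nat)
      exact (integrable_finsetSum _ fun n _ => hFi n).aestronglyMeasurable
    · rw [← (hFsum y).tsum_eq, ← tsum_mul_left]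
      exact tsum_of_norm_bounded (hS.mul_left _).hasSum fun n => hFn n y
  · have hs : Summable fun n => ∫ y, ‖F n y‖ := by
      refine Summable.of_nonneg_of_le (fun n => integral_nonneg fun _ => norm_nonneg _)
        (fun n => ?_) (hS.mul_left ‖θ‖)
      rw [norm_L1_eq, ← integral_mul_const]
      exact integral_mono (hFi n).norm (hθi.norm.mul_const _) (hFn n)
    have h := hasSum_integral_of_summable_integral_norm hFi hs
    simp_rw [fun y => (hFsum y).tsum_eq] at h
    refine h.congr_fun fun n => ?_
    simp only [F]
    rw [integral_const_mul, ← integral_integral_swap (integrable_birth hB.1 hk hK0 φ hε θ n)]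

lemma integrable_hatRen_mul :
    Integrable (fun η => hatRen φ z ε (coherent θ) η * k η) (lebesguePoisson d) ∧
    HasSum (fun n : ℕ => (n.factorial : ℂ)⁻¹ *
        (-((n : ℂ) * ∫ x : Fin n → Space d, (∏ i, θ (x i)) * k (cfg d n x)) +
          z * ∫ x, ∫ y, birth φ ε θ k n y x))
      (∫ η, hatRen φ z ε (coherent θ) η * k η ∂(lebesguePoisson d)) := by
  have hm := (measurable_hatRen_coherent hd φ z hε θ).mul hB.1
  have hθi := L1.integrable_coeFn θ
  have hae : ∀ n, ∀ᵐ x, hatRen φ z ε (coherent θ) (cfg d n x) * k (cfg d n x) =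
      -((n : ℂ) * ((∏ i, θ (x i)) * k (cfg d n x))) +
        z * ∫ y, birth φ ε θ k n y x := fun n => by
    filter_upwards [hatRen_coherent_cfg hd φ z hε θ n] with x hx
    simp only [birth, ← mul_assoc]
    rw [hx, integral_mul_const]
    ring
  have hi1 := fun n => ((integrable_prod_mul_of_hasWeight hB.1 hk hθi n).const_mul (n : ℂ)).neg
  have hi2 := fun n => (integrable_integral_birth hB.1 hk hK0 φ hε θ n).const_mul (z : ℂ)
  have hi : Integrable (fun η => hatRen φ z ε (coherent θ) η * k η) (lebesguePoisson d) := by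
    have hb := (hK _ (norm_nonneg θ)).add
      ((hK.summable hK0 (shiftBound_nonneg φ θ)).mul_left (|z| * ‖θ‖))
    refine integrable_lebesguePoisson hd hm hb (fun n => ?_) fun n => ?_
    · exact ((hi1 n).add (hi2 n)).congr ((hae n).mono fun x hx => hx.symm)
    · have h1 : ∫ x, ‖hatRen φ z ε (coherent θ) (cfg d n x) * k (cfg d n x)‖ ≤
          (n : ℝ) * (K n * ‖θ‖ ^ n) + |z| * (‖θ‖ * (K n * shiftBound φ θ ^ n)) := by
        calc _ = ∫ x, ‖-((n : ℂ) * ((∏ i, θ (x i)) * k (cfg d n x))) +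
              z * ∫ y, birth φ ε θ k n y x‖ :=
              integral_congr_ae ((hae n).mono fun x hx => by simp only [hx])
          _ ≤ ∫ x, ((n : ℝ) * ‖(∏ i, θ (x i)) * k (cfg d n x)‖ +
              |z| * ‖∫ y, birth φ ε θ k n y x‖) := by
              refine integral_mono ((hi1 n).add (hi2 n)).norm
                (((integrable_prod_mul_of_hasWeight hB.1 hk hθi n).norm.const_mul _).add
                  ((integrable_integral_birth hB.1 hk hK0 φ hε θ n).norm.const_mul _))
                fun x => ?_
              refine (norm_add_le _ _).trans_eq ?_
              rw [norm_neg, norm_mul, norm_mul (z : ℂ), Complex.norm_natCast, Complex.norm_real,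
                Real.norm_eq_abs]
          _ ≤ _ := by
              rw [integral_add ((integrable_prod_mul_of_hasWeight hB.1 hk hθi n).norm.const_mul _)
                ((integrable_integral_birth hB.1 hk hK0 φ hε θ n).norm.const_mul _),
                integral_const_mul, integral_const_mul]
              have h2 := integral_norm_prod_mul_le hB.1 hk hθi n
              rw [← norm_L1_eq] at h2
              have h3 := integral_norm_integral_birth_le hB.1 hk hK0 φ hε θ n
              gcongr
      have hKn := hK0 n
      calc (n.factorial : ℝ)⁻¹ * ∫ x, ‖hatRen φ z ε (coherent θ) (cfg d n x) * k (cfg d n x)‖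
          ≤ (n.factorial : ℝ)⁻¹ * (((n : ℝ) + 1) * (K n * ‖θ‖ ^ n) +
              |z| * (‖θ‖ * (K n * shiftBound φ θ ^ n))) := by
            refine mul_le_mul_of_nonneg_left (h1.trans ?_) (by positivity)
            gcongr
            linarith
        _ = _ := by ring
  refine ⟨hi, (hasSum_integral_lebesguePoisson hd hm hi).congr_fun fun n => ?_⟩
  congr 1
  rw [← integral_const_mul, ← integral_const_mul, ← integral_neg]
  refine (integral_congr_ae ((hae n).mono fun x hx => ?_)).trans (integral_add (hi1 n) (hi2 n)) |>.symm
  exact hx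

end Main

end Generator

lemma exists_isVariationalDerivative {d : ℕ} {B : L1 d → ℂ} (hf : BddEntire B) (θ : L1 d) :
    ∃ g, IsVariationalDerivative B θ g := by
  obtain ⟨Λ, hΛ⟩ := hf.exists_hasDerivAt θ
  obtain ⟨g, hgm, hgb, hg⟩ := exists_bounded_of_dual_L1 Λ
  exact ⟨g, memLp_top_of_bound hgm.aestronglyMeasurable _ (ae_of_all _ hgb), fun h =>
    (hg h) ▸ hΛ h⟩

lemma IsVariationalDerivative.integrable_mul {d : ℕ} {B : L1 d → ℂ} {θ : L1 d} {g : Space d → ℂ}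
    (hg : IsVariationalDerivative B θ g) (h : L1 d) : Integrable fun x => g x * h x :=
  memLp_one_iff_integrable.1 ((Lp.memLp h).mul hg.1)

lemma IsVariationalDerivative.ae_eq {d : ℕ} {B : L1 d → ℂ} {θ : L1 d} {g g' : Space d → ℂ}
    (hg : IsVariationalDerivative B θ g) (hg' : IsVariationalDerivative B θ g') :
    g =ᵐ[volume] g' := by
  have key : ∀ {u : Space d → ℂ} (_ : IsVariationalDerivative B θ u) (E : FinMeasSet volume),
      (fun x => u x * ind E x) =ᵐ[volume] E.1.indicator u := fun {u} _ E => by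
    filter_upwards [coeFn_ind E] with x hx
    rw [hx]
    by_cases h : x ∈ E.1 <;> simp [h]
  refine ae_eq_of_forall_setIntegral_eq_of_sigmaFinite (fun s hs hμ => ?_) (fun s hs hμ => ?_)
    fun s hs hμ => ?_
  · rw [← integrable_indicator_iff hs]
    exact (hg.integrable_mul (ind ⟨s, hs, hμ.ne⟩)).congr (key hg _)
  · rw [← integrable_indicator_iff hs]
    exact (hg'.integrable_mul (ind ⟨s, hs, hμ.ne⟩)).congr (key hg' _)
  · rw [← integral_indicator hs, ← integral_indicator hs,
      ← integral_congr_ae (key hg ⟨s, hs, hμ.ne⟩), ← integral_congr_ae (key hg' ⟨s, hs, hμ.ne⟩)]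
    exact (hg.2 _).unique (hg'.2 _)

end GlauberGF

end

theorem proposition4p1 (d : ℕ) (hd : 0 < d) (φ : GlauberGF.PairPotential d)
    (z : ℝ) (hz : 0 < z) (B : GlauberGF.L1 d → ℂ) (hB : GlauberGF.IsEntire B)
    (hB' : GlauberGF.IsOfBoundedType B) :
    -- `B` has a correlation function, unique almost everywhere
    (GlauberGF.IsCorrelationFunction B (GlauberGF.correlationFunction B) ∧
      ∀ k, GlauberGF.IsCorrelationFunction B k →
        k =ᵐ[GlauberGF.lebesguePoisson d] GlauberGF.correlationFunction B) ∧
    -- `B` has a variational derivative at every point, unique almost everywhere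
    (∀ θ : GlauberGF.L1 d,
      GlauberGF.IsVariationalDerivative B θ (GlauberGF.variationalDerivative B θ) ∧
      ∀ g, GlauberGF.IsVariationalDerivative B θ g →
        g =ᵐ[volume] GlauberGF.variationalDerivative B θ) ∧
    -- both integrals converge absolutely and are equal
    ∀ ε : ℝ, 0 < ε → ∀ θ : GlauberGF.L1 d,
      Integrable (fun η => GlauberGF.hatRen φ z ε (GlauberGF.coherent θ) η *
        GlauberGF.correlationFunction B η) (GlauberGF.lebesguePoisson d) ∧
      Integrable (fun x => θ x * (GlauberGF.variationalDerivative B θ x -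
        (z : ℂ) * B (GlauberGF.shift φ ε θ x))) volume ∧
      GlauberGF.tildeRen φ z ε B θ =
        -∫ x, θ x * (GlauberGF.variationalDerivative B θ x -
          (z : ℂ) * B (GlauberGF.shift φ ε θ x)) := by
  have hf := hB.bddEntire hB'
  obtain ⟨k₀, K, hk₀, hK0, hK, hw₀⟩ := GlauberGF.exists_correlationFunction hd hf
  have hex : ∃ k, GlauberGF.IsCorrelationFunction B k := ⟨k₀, hk₀⟩
  have hc : GlauberGF.IsCorrelationFunction B (GlauberGF.correlationFunction B) := by
    rw [GlauberGF.correlationFunction, dif_pos hex]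
    exact hex.choose_spec
  have hw : GlauberGF.HasWeight (GlauberGF.correlationFunction B) K := fun n => by
    filter_upwards [GlauberGF.ae_cfg_of_ae hd (hc.ae_eq hd hk₀) n, hw₀ n] with x hx hx'
    rw [hx]
    exact hx'
  have hv : ∀ θ, GlauberGF.IsVariationalDerivative B θ (GlauberGF.variationalDerivative B θ) :=
    fun θ => by
      rw [GlauberGF.variationalDerivative, dif_pos (GlauberGF.exists_isVariationalDerivative hf θ)]
      exact (GlauberGF.exists_isVariationalDerivative hf θ).choose_spec
  refine ⟨⟨hc, fun k hk => hk.ae_eq hd hc⟩, fun θ => ⟨hv θ, fun g hg => hg.ae_eq (hv θ)⟩,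
    fun ε hε θ => ?_⟩
  obtain ⟨hi, hsum⟩ := GlauberGF.integrable_hatRen_mul hd hc hw hK0 hK φ z hε θ
  obtain ⟨hbi, hbirth⟩ := GlauberGF.hasSum_integral_birth hd hc hw hK0 hK φ hε θ
  have hnum := GlauberGF.hasSum_number hd hc θ hf (hv θ)
  have e : (fun x => θ x * (GlauberGF.variationalDerivative B θ x -
      (z : ℂ) * B (GlauberGF.shift φ ε θ x))) = fun x =>
      GlauberGF.variationalDerivative B θ x * θ x - z * (θ x * B (GlauberGF.shift φ ε θ x)) := by
    funext x; ring
  rw [e]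
  have hvi := (hv θ).integrable_mul θ
  refine ⟨hi, hvi.sub (hbi.const_mul _), ?_⟩
  rw [integral_sub hvi (hbi.const_mul _), integral_const_mul, GlauberGF.tildeRen]
  refine hsum.unique ?_
  rw [neg_sub, sub_eq_neg_add]
  refine (hnum.neg.add (hbirth.mul_left (z : ℂ))).congr_fun fun n => ?_
  ring
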